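/- Fix $m\in\mathbb{N}\cup\{0\}$. For a smooth immersed plane curve $\gamma:[-1,1]\to\mathbb{R}^2$ let $s$ be arclength, $\tau=\gamma_s$, $\nu$ the rotation of $\tau$ by $\pi/2$, $k=\langle\gamma_{ss},\nu\rangle$, and let $k_{s^\ell}$ be the $\ell$-th arclength derivative of $k$. Let $\eta_\pm$ be two parallel lines at distance $d_0>0$. We say that $\gamma$ satisfies the generalised Neumann boundary conditions if $\gamma(\pm1)\in\eta_\pm$, $\gamma$ is orthogonal to $\eta_\pm$ at $\gamma(\pm1)$, and $k_s,k_{s^3},\dots,k_{s^{2m+1}}$ vanish at $\pm1$. A solution on $[0,T)$, $0<T\le\infty$, with initial curve $\gamma_0$ is a map $\gamma:[-1,1]\times[0,T)\to\mathbb{R}^2$, smooth up to the boundary and up to $t=0$, such that each $\gamma(\cdot,t)$ is an immersed curve satisfying the generalised Neumann boundary conditions, $\gamma(\cdot,0)=\gamma_0$, and $$\frac{\partial\gamma}{\partial t}=(-1)^{m+1}k_{s^{2m+2}}\,\nu .$$ **Corollary 3.4.** There are a constant $\varepsilon>0$, depending only on $m$, and rates $\delta_{\ell,m}>0$, $\delta'_{\ell,m}>0$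 ($\ell\in\mathbb{N}\cup\{0\}$), depending only on $\ell$, $m$, $\varepsilon$ and $L_0$, such that the following holds for every smooth immersed curve $\gamma_0$ of length $L_0$ and curvature $\kappa$ that satisfies the generalised Neumann boundary conditions and has winding number $\omega=\frac1{2\pi}\int\kappa\,ds=0$. (a) If $\int\kappa^2\,ds\le\varepsilon$ and $\gamma$ is a solution with initial curve $\gamma_0$ that exists for all time ($T=\infty$), then for every $\ell\ge0$ there are constants $\tilde C_{m,\ell},\tilde C'_{m,\ell}$ (depending on $m$, $\ell$ and the solution) such that for all $t\ge0$ $$\int k_{s^\ell}^2\,ds\le\tilde C_{m,\ell}\,e^{-\delta_{\ell,m}t}\qquad\text{and}\qquad \|k_{s^\ell}\|_\infty\le\tilde C'_{m,\ell}\,e^{-\delta'_{\ell,m}t}.$$ (b) If $L_0\int\kappa^2\,ds\le\varepsilon$, then for every $\ell\ge0$ there are constants $\tilde C_{m,\ell},\tilde C'_{m,\ell}$, depending only on $m$, $\ell$ and $\gamma_0$, such that the two estimates of (a) hold for every solution with initial curve $\gamma_0$ on any interval $[0,T)$, $0<T\le\infty$, and all $t\in[0,T)$. -/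

import Mathlib

open Set MeasureTheory
open scoped ContDiff

noncomputable section

namespace PolyharmonicFlow

/-- The Euclidean plane. -/
abbrev Plane : Type := EuclideanSpace ℝ (Fin 2)

/-- The parameter interval `[-1, 1]` of all curves. -/
abbrev paramInterval : Set ℝ := Icc (-1 : ℝ) 1

/-- Rotation of the plane by the angle `π / 2` (counterclockwise). -/
def rot (v : Plane) : Plane := !₂[-(v 1), v 0]

/-- The velocity `c'(x)` of a curve `c : [-1, 1] → ℝ²` (one-sided at the end points). -/
def velocity (c : ℝ → Plane) (x : ℝ) : Plane := derivWithin c paramInterval x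

/-- The speed `|c'(x)|`, so that `ds = |c'(x)| dx`. -/
def speed (c : ℝ → Plane) (x : ℝ) : ℝ := ‖velocity c x‖

/-- The arclength derivative `f_s = f' / |c'|` of a function `f` along the curve `c`. -/
def arcDeriv {E : Type*} [NormedAddCommGroup E] [NormedSpace ℝ E]
    (c : ℝ → Plane) (f : ℝ → E) (x : ℝ) : E :=
  (speed c x)⁻¹ • derivWithin f paramInterval x

/-- The unit tangent `τ = c_s`. -/
def tangent (c : ℝ → Plane) : ℝ → Plane := arcDeriv c c

/-- The unit normal `ν`, the tangent rotated by `π / 2`. -/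
def normal (c : ℝ → Plane) (x : ℝ) : Plane := rot (tangent c x)

/-- The signed curvature `k = ⟨c_ss, ν⟩`. -/
def curvature (c : ℝ → Plane) (x : ℝ) : ℝ := inner ℝ (arcDeriv c (tangent c) x) (normal c x)

/-- The `ℓ`-th iterated arclength derivative `k_{s^ℓ}` of the curvature. -/
def curvatureDeriv (c : ℝ → Plane) (ℓ : ℕ) : ℝ → ℝ := (arcDeriv c)^[ℓ] (curvature c)

/-- The integral `∫ f ds` along the curve `c`. -/
def arcIntegral (c : ℝ → Plane) (f : ℝ → ℝ) : ℝ := ∫ x in (-1 : ℝ)..1, f x * speed c x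

/-- The length of the curve `c`. -/
def length (c : ℝ → Plane) : ℝ := arcIntegral c (fun _ => 1)

/-- The winding number `ω = (2π)⁻¹ ∫ k ds`. -/
def windingNumber (c : ℝ → Plane) : ℝ := (2 * Real.pi)⁻¹ * arcIntegral c (curvature c)

/-- The straight line with normal vector `e` at signed distance `a` from the origin
(for a unit vector `e`); its direction is `rot e`. -/
def supportLine (e : Plane) (a : ℝ) : Set Plane := {p | inner ℝ e p = a}

/-- `c : [-1, 1] → ℝ²` is a smooth immersed curve that satisfies the `m + 2` generalised Neumann
boundary conditions on the parallel lines `supportLine e a` and `supportLine e (a + d)`: it ends on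
the lines, it is orthogonal to them there, and `k_s, k_{s^3}, …, k_{s^{2m+1}}` vanish at both ends.
-/
structure IsNeumannCurve (m : ℕ) (e : Plane) (a d : ℝ) (c : ℝ → Plane) : Prop where
  smooth : ContDiffOn ℝ ∞ c paramInterval
  immersed : ∀ x ∈ paramInterval, velocity c x ≠ 0
  left_mem : c (-1) ∈ supportLine e a
  right_mem : c 1 ∈ supportLine e (a + d)
  left_orthogonal : inner ℝ (velocity c (-1)) (rot e) = 0
  right_orthogonal : inner ℝ (velocity c 1) (rot e) = 0
  left_odd : ∀ j ≤ m, curvatureDeriv c (2 * j + 1) (-1) = 0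
  right_odd : ∀ j ≤ m, curvatureDeriv c (2 * j + 1) 1 = 0

/-- The time interval `[0, T)`, where `T = ⊤` stands for `T = ∞`. -/
def timeInterval (T : EReal) : Set ℝ := {t | 0 ≤ t ∧ (t : EReal) < T}

/-- `γ`, with `γ t x` the point at time `t` and parameter `x`, is a smooth solution on
`[-1, 1] × [0, T)` of the polyharmonic curve diffusion flow `∂γ/∂t = (-1)^{m+1} k_{s^{2m+2}} ν`
with initial curve `γ₀` and generalised Neumann boundary conditions. -/
structure IsSolution (m : ℕ) (e : Plane) (a d : ℝ) (γ₀ : ℝ → Plane) (T : EReal)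
    (γ : ℝ → ℝ → Plane) : Prop where
  smooth : ContDiffOn ℝ ∞ (fun p : ℝ × ℝ => γ p.1 p.2) (timeInterval T ×ˢ paramInterval)
  neumann : ∀ t ∈ timeInterval T, IsNeumannCurve m e a d (γ t)
  flow : ∀ t ∈ timeInterval T, ∀ x ∈ paramInterval,
    HasDerivWithinAt (fun r => γ r x)
      (((-1 : ℝ) ^ (m + 1) * curvatureDeriv (γ t) (2 * m + 2) x) • normal (γ t) x)
      (timeInterval T) t
  initial : ∀ x ∈ paramInterval, γ 0 x = γ₀ x

end PolyharmonicFlow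

end

noncomputable section

namespace PolyharmonicFlow

/-! ### Log-convex sequences -/

/-! Write E_j for the squared L² norm of k_{s^j}, L for the length and F for the normal velocity.
The proof is an energy method in which every boundary term vanishes.

Differentiating the boundary conditions in time shows that all odd derivatives of k vanish at the
ends (`curv_odd_eq_zero`). Hence ∫ k ds is conserved and stays zero, and every k_{s^j} has a zero.
This gives the Poincaré inequality E_j ≤ L² E_{j+1}. Integration by parts gives E_{j+1}² ≤ E_j
E_{j+2}, so all intermediate energies interpolate between E_0 and a top one.

Along the flow L' = -E_{m+1}, and with N = ℓ+m+2 the derivative of E_ℓ is -2 E_N plus integrals of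
products of four derivatives of k with total order 2(N-1) (`exists_hasDerivAt_curvEnergy`). Up to a
combinatorial factor these are at most S, where S^{2N} = 4^N E_0^{2N+1} E_N^{2N-1} (`abs_quad_le`).
This S is used in two ways: S ≤ 2 (L E_0) E_N (`quarticBound_le_length`), or S ≤ η E_N + C_η
E_0^{2N+1} (`quarticBound_le_add`).

If the scale-invariant quantity L E_0 is small at one time, the first form keeps it small afterwards
and, with Poincaré, gives E_0' ≤ -λ E_0 for λ = L₀^{-2(m+2)}. The second form then gives E_ℓ' ≤ -λ
E_ℓ + C e^{-2λt}, so every E_ℓ decays at rate λ (`curvEnergy_le`). The supremum of k_{s^ℓ} is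
controlled by E_{ℓ+1} and decays at rate λ/2.

In (b) smallness holds at time 0. In (a) it holds at some later time: were L E_0 bounded below
forever, E_{m+1} would be too, and L would reach zero in finite time (`exists_small`). The compact
interval before that time costs only a constant. -/

lemma pow_succ_le_of_logConvex {A : ℕ → ℝ} (h0 : ∀ j, 0 ≤ A j)
    (h : ∀ j, A (j + 1) ^ 2 ≤ A j * A (j + 2)) (j : ℕ) :
    A j ^ (j + 1) ≤ A 0 * A (j + 1) ^ j := by
  induction j with
  | zero => simp
  | succ j ih =>
    -- The step cancels `A (j + 1) ^ j`, so a vanishing term is treated apart.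
    rcases (h0 (j + 1)).eq_or_lt with hz | hp
    · rw [← hz, zero_pow (by omega)]
      exact mul_nonneg (h0 _) (pow_nonneg (h0 _) _)
    · have h1 : A (j + 1) ^ j * A (j + 1) ^ (j + 2)
          ≤ A (j + 1) ^ j * (A 0 * A (j + 2) ^ (j + 1)) := by
        calc A (j + 1) ^ j * A (j + 1) ^ (j + 2) = (A (j + 1) ^ 2) ^ (j + 1) := by ring
          _ ≤ (A j * A (j + 2)) ^ (j + 1) := by
            gcongr
            exact h j
          _ = A j ^ (j + 1) * A (j + 2) ^ (j + 1) := by ring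
          _ ≤ (A 0 * A (j + 1) ^ j) * A (j + 2) ^ (j + 1) :=
            mul_le_mul_of_nonneg_right ih (pow_nonneg (h0 _) _)
          _ = A (j + 1) ^ j * (A 0 * A (j + 2) ^ (j + 1)) := by ring
      exact le_of_mul_le_mul_left h1 (pow_pos hp _)

/-- Convexity of log A places its value at j below the chord from 0 to j + i. The power form allows
zero terms. -/
lemma pow_le_of_logConvex {A : ℕ → ℝ} (h0 : ∀ j, 0 ≤ A j)
    (h : ∀ j, A (j + 1) ^ 2 ≤ A j * A (j + 2)) (j i : ℕ) :
    A j ^ (j + i) ≤ A 0 ^ i * A (j + i) ^ j := by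
  induction i with
  | zero => simp
  | succ i ih =>
    rcases Nat.eq_zero_or_pos (j + i) with hz | hp
    · obtain ⟨rfl, rfl⟩ : j = 0 ∧ i = 0 := by omega
      simp
    -- After raising to the power j + i, the one-step estimate at index j + i applies to a full
    -- power of `A (j + i)`.
    · refine (pow_le_pow_iff_left₀ (pow_nonneg (h0 _) _)
        (mul_nonneg (pow_nonneg (h0 _) _) (pow_nonneg (h0 _) _)) hp.ne').1 ?_
      have hN := pow_succ_le_of_logConvex h0 h (j + i)
      have hA := h0 0
      have hB := h0 j
      have hC := h0 (j + i)
      have hD := h0 (j + i + 1)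
      calc (A j ^ (j + (i + 1))) ^ (j + i) = (A j ^ (j + i)) ^ (j + i + 1) := by ring
        _ ≤ (A 0 ^ i * A (j + i) ^ j) ^ (j + i + 1) := by gcongr
        _ = A 0 ^ (i * (j + i + 1)) * (A (j + i) ^ (j + i + 1)) ^ j := by ring
        _ ≤ A 0 ^ (i * (j + i + 1)) * (A 0 * A (j + i + 1) ^ (j + i)) ^ j := by gcongr
        _ = (A 0 ^ (i + 1) * A (j + (i + 1)) ^ j) ^ (j + i) := by
          rw [← add_assoc]; ring

/-! ### Weighted integrals over the parameter interval -/

/-- The integral of `f` over `[-1, 1]` with density `v`. -/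
def wint (v f : ℝ → ℝ) : ℝ := ∫ x in (-1 : ℝ)..1, f x * v x

lemma uIcc_param : uIcc (-1 : ℝ) 1 = paramInterval := uIcc_of_le (by norm_num)

lemma intervalIntegrable_of_continuousOn {f : ℝ → ℝ} (hf : ContinuousOn f paramInterval) :
    IntervalIntegrable f volume (-1) 1 :=
  ContinuousOn.intervalIntegrable (by rwa [uIcc_param])

lemma wint_congr {v f g : ℝ → ℝ} (h : ∀ x ∈ paramInterval, f x = g x) : wint v f = wint v g := by
  refine intervalIntegral.integral_congr fun x hx => ?_
  rw [uIcc_param] at hx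
  simp only [h x hx]

lemma wint_add {v : ℝ → ℝ} (hv : ContinuousOn v paramInterval)
    {f g : ℝ → ℝ} (hf : ContinuousOn f paramInterval)
    (hg : ContinuousOn g paramInterval) :
    wint v (fun x => f x + g x) = wint v f + wint v g := by
  unfold wint
  simp only [add_mul]
  exact intervalIntegral.integral_add (intervalIntegrable_of_continuousOn (hf.mul hv))
    (intervalIntegrable_of_continuousOn (hg.mul hv))

lemma wint_const_mul {v : ℝ → ℝ} (c : ℝ) (f : ℝ → ℝ) : wint v (fun x => c * f x) = c * wint v f := by
  unfold wint
  rw [← intervalIntegral.integral_const_mul]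
  simp only [mul_assoc]

lemma wint_mono {v : ℝ → ℝ} (hv : ContinuousOn v paramInterval)
    (hpos : ∀ x ∈ paramInterval, 0 < v x)
    {f g : ℝ → ℝ} (hf : ContinuousOn f paramInterval)
    (hg : ContinuousOn g paramInterval) (h : ∀ x ∈ paramInterval, f x ≤ g x) :
    wint v f ≤ wint v g :=
  intervalIntegral.integral_mono_on (by norm_num) (intervalIntegrable_of_continuousOn (hf.mul hv))
    (intervalIntegrable_of_continuousOn (hg.mul hv))
    fun x hx => mul_le_mul_of_nonneg_right (h x hx) (hpos x hx).le

lemma wint_nonneg {v : ℝ → ℝ} (hpos : ∀ x ∈ paramInterval, 0 < v x)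
    {f : ℝ → ℝ} (h : ∀ x ∈ paramInterval, 0 ≤ f x) : 0 ≤ wint v f :=
  intervalIntegral.integral_nonneg (by norm_num) fun x hx => mul_nonneg (h x hx) (hpos x hx).le

lemma abs_wint_le {v : ℝ → ℝ} (hv : ContinuousOn v paramInterval)
    (hpos : ∀ x ∈ paramInterval, 0 < v x)
    {f : ℝ → ℝ} (hf : ContinuousOn f paramInterval) :
    |wint v f| ≤ wint v (fun x => |f x|) := by
  rw [abs_le]
  constructor
  · have := wint_mono hv hpos (f := fun x => (-1) * |f x|) (g := f) (by fun_prop) hf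
      (fun x _ => by simpa using neg_abs_le (f x))
    rw [wint_const_mul] at this
    linarith
  · exact wint_mono hv hpos hf hf.abs fun x _ => le_abs_self _

/-- The Cauchy–Schwarz inequality. -/
lemma wint_mul_sq_le {v : ℝ → ℝ} (hv : ContinuousOn v paramInterval)
    (hpos : ∀ x ∈ paramInterval, 0 < v x)
    {f g : ℝ → ℝ} (hf : ContinuousOn f paramInterval)
    (hg : ContinuousOn g paramInterval) :
    wint v (fun x => f x * g x) ^ 2 ≤ wint v (fun x => f x ^ 2) * wint v (fun x => g x ^ 2) := by
  have key : ∀ t : ℝ, 0 ≤ wint v (fun x => g x ^ 2) * (t * t)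
      + (2 * wint v (fun x => f x * g x)) * t + wint v (fun x => f x ^ 2) := by
    intro t
    have h0 := wint_nonneg (v := v) hpos (f := fun x => (f x + t * g x) ^ 2)
      (fun x _ => sq_nonneg _)
    have h1 : wint v (fun x => (f x + t * g x) ^ 2)
        = wint v (fun x => (f x ^ 2 + (2 * t) * (f x * g x)) + (t * t) * (g x ^ 2)) :=
      wint_congr fun x _ => by ring
    rw [h1, wint_add hv (by fun_prop) (by fun_prop), wint_add hv (by fun_prop) (by fun_prop),
      wint_const_mul, wint_const_mul] at h0
    linarith
  have := discrim_le_zero key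
  unfold discrim at this
  nlinarith

/-- A function with a zero is bounded by the integral of its arclength derivative. -/
lemma abs_le_wint_of_zero {v : ℝ → ℝ} (hv : ContinuousOn v paramInterval)
    (hpos : ∀ x ∈ paramInterval, 0 < v x)
    {f g : ℝ → ℝ}
    (hd : ∀ x ∈ paramInterval, HasDerivWithinAt f (v x * g x) paramInterval x)
    (hg : ContinuousOn g paramInterval) {z : ℝ} (hz : z ∈ paramInterval) (hfz : f z = 0)
    {x : ℝ} (hx : x ∈ paramInterval) : |f x| ≤ wint v (fun y => |g y|) := by
  have hcont : ContinuousOn f paramInterval := fun y hy => (hd y hy).continuousWithinAt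
  have main : ∀ a ∈ paramInterval, ∀ b ∈ paramInterval, a ≤ b →
      |f b - f a| ≤ wint v (fun y => |g y|) := by
    intro a ha b hb hab
    have hsub : Icc a b ⊆ paramInterval := Icc_subset_Icc ha.1 hb.2
    have hint : IntervalIntegrable (fun y => v y * g y) volume a b :=
      ((hv.mul hg).mono (by rwa [uIcc_of_le hab])).intervalIntegrable
    rw [← intervalIntegral.integral_eq_sub_of_hasDerivAt_of_le hab (hcont.mono hsub)
      (fun y hy => (hd y (hsub ⟨hy.1.le, hy.2.le⟩)).hasDerivAt
        (Icc_mem_nhds (ha.1.trans_lt hy.1) (hy.2.trans_le hb.2))) hint]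
    refine (intervalIntegral.abs_integral_le_integral_abs hab).trans ?_
    have hnn : ∀ y ∈ paramInterval, 0 ≤ |g y| * v y := fun y hy =>
      mul_nonneg (abs_nonneg _) (hpos y hy).le
    calc ∫ y in a..b, |v y * g y| = ∫ y in a..b, |g y| * v y := by
          refine intervalIntegral.integral_congr fun y hy => ?_
          rw [uIcc_of_le hab] at hy
          simp only [abs_mul, abs_of_pos (hpos y (hsub hy)), mul_comm]
      _ ≤ ∫ y in (-1 : ℝ)..1, |g y| * v y :=
          intervalIntegral.integral_mono_interval ha.1 hab hb.2
            ((ae_restrict_iff' measurableSet_Ioc).2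
              (Filter.Eventually.of_forall fun y hy => hnn y ⟨hy.1.le, hy.2⟩))
            (intervalIntegrable_of_continuousOn (hg.abs.mul hv))
  rcases le_total z x with h | h
  · simpa [hfz] using main z hz x hx h
  · simpa [hfz] using main x hx z hz h

lemma wint_deriv {v : ℝ → ℝ} (hv : ContinuousOn v paramInterval)
    {f g : ℝ → ℝ}
    (hd : ∀ x ∈ paramInterval, HasDerivWithinAt f (v x * g x) paramInterval x)
    (hg : ContinuousOn g paramInterval) : wint v g = f 1 - f (-1) := by
  have hcont : ContinuousOn f paramInterval := fun y hy => (hd y hy).continuousWithinAt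
  refine intervalIntegral.integral_eq_sub_of_hasDerivAt_of_le (by norm_num) hcont
      (fun y hy => ?_) (intervalIntegrable_of_continuousOn (hg.mul hv))
  rw [mul_comm]
  exact (hd y ⟨hy.1.le, hy.2.le⟩).hasDerivAt (Icc_mem_nhds hy.1 hy.2)

/-- A continuous function without zeros has one sign on an interval, so its integral against a
positive density is nonzero. -/
lemma exists_zero_of_wint_eq_zero {v : ℝ → ℝ} (hv : ContinuousOn v paramInterval)
    (hpos : ∀ x ∈ paramInterval, 0 < v x)
    {f : ℝ → ℝ} (hf : ContinuousOn f paramInterval)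
    (h : wint v f = 0) : ∃ z ∈ paramInterval, f z = 0 := by
  by_contra! hne
  have hpi : IsPreconnected paramInterval := isPreconnected_Icc
  have h1 : (1 : ℝ) ∈ paramInterval := by simp
  have sgn : (∀ x ∈ paramInterval, 0 < f x) ∨ (∀ x ∈ paramInterval, f x < 0) := by
    rcases (hne 1 h1).lt_or_gt with h' | h'
    · right
      intro x hx
      by_contra! hc
      obtain ⟨z, hz, hz0⟩ := hpi.intermediate_value h1 hx hf ⟨h'.le, hc⟩
      exact hne z hz hz0
    · left
      intro x hx
      by_contra! hc
      obtain ⟨z, hz, hz0⟩ := hpi.intermediate_value hx h1 hf ⟨hc, h'.le⟩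
      exact hne z hz hz0
  rcases sgn with hs | hs
  · have : 0 < wint v f := intervalIntegral.intervalIntegral_pos_of_pos_on
      (intervalIntegrable_of_continuousOn (hf.mul hv))
      (fun x hx => mul_pos (hs x ⟨hx.1.le, hx.2.le⟩) (hpos x ⟨hx.1.le, hx.2.le⟩)) (by norm_num)
    exact this.ne' h
  · have : 0 < wint v (fun x => (-1) * f x) := intervalIntegral.intervalIntegral_pos_of_pos_on
      (intervalIntegrable_of_continuousOn (by fun_prop))
      (fun x hx => mul_pos (by linarith [hs x ⟨hx.1.le, hx.2.le⟩])
        (hpos x ⟨hx.1.le, hx.2.le⟩)) (by norm_num)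
    rw [wint_const_mul, h] at this
    simp at this

/-! ### Towers of arclength derivatives -/

/-- `k (i + 1)` is the arclength derivative of `k i`, where `v` is the speed. -/
structure ArcTower (v : ℝ → ℝ) (k : ℕ → ℝ → ℝ) : Prop where
  cont : ContinuousOn v paramInterval
  pos : ∀ x ∈ paramInterval, 0 < v x
  deriv : ∀ i, ∀ x ∈ paramInterval, HasDerivWithinAt (k i) (v x * k (i + 1) x) paramInterval x

/-- All members of odd order vanish at the end points. -/
def OddVanish (k : ℕ → ℝ → ℝ) : Prop := ∀ j, Odd j → k j (-1) = 0 ∧ k j 1 = 0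

/-- The squared `L²` norm of the `j`-th arclength derivative. -/
def energy (v : ℝ → ℝ) (k : ℕ → ℝ → ℝ) (j : ℕ) : ℝ := wint v (fun x => k j x ^ 2)

/-- The integral of a product of four members of a tower. -/
def quad (v : ℝ → ℝ) (k : ℕ → ℝ → ℝ) (a b c d : ℕ) : ℝ :=
  wint v (fun x => k a x * k b x * k c x * k d x)

lemma quad_swap_right (v : ℝ → ℝ) (k : ℕ → ℝ → ℝ) (a b c d : ℕ) :
    quad v k a b c d = quad v k a b d c :=
  wint_congr fun x _ => by ring

lemma quad_swap_mid (v : ℝ → ℝ) (k : ℕ → ℝ → ℝ) (a b c d : ℕ) :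
    quad v k a b c d = quad v k a d c b :=
  wint_congr fun x _ => by ring

lemma quad_swap_outer (v : ℝ → ℝ) (k : ℕ → ℝ → ℝ) (a b c d : ℕ) :
    quad v k a b c d = quad v k d b c a :=
  wint_congr fun x _ => by ring

namespace ArcTower

variable {v : ℝ → ℝ} {k : ℕ → ℝ → ℝ}

lemma continuousOn (h : ArcTower v k) (i : ℕ) : ContinuousOn (k i) paramInterval :=
  fun x hx => (h.deriv i x hx).continuousWithinAt

lemma energy_nonneg (h : ArcTower v k) (j : ℕ) : 0 ≤ energy v k j :=
  wint_nonneg h.pos fun _ _ => sq_nonneg _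

lemma wint_one_pos (h : ArcTower v k) : 0 < wint v (fun _ => 1) :=
  intervalIntegral.intervalIntegral_pos_of_pos_on
    (intervalIntegrable_of_continuousOn (continuousOn_const.mul h.cont))
    (fun x hx => mul_pos one_pos (h.pos x ⟨hx.1.le, hx.2.le⟩)) (by norm_num)

lemma wint_succ (h : ArcTower v k) (j : ℕ) : wint v (k (j + 1)) = k j 1 - k j (-1) :=
  wint_deriv h.cont (h.deriv j) (h.continuousOn _)

lemma wint_mul_succ (h : ArcTower v k) (ho : OddVanish k) {a b : ℕ} (hab : Odd (a + b)) :
    wint v (fun x => k a x * k (b + 1) x) = -wint v (fun x => k (a + 1) x * k b x) := by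
  have ca := h.continuousOn a
  have cb := h.continuousOn b
  have ca' := h.continuousOn (a + 1)
  have cb' := h.continuousOn (b + 1)
  have h1 := wint_deriv h.cont (f := fun x => k a x * k b x)
    (g := fun x => k a x * k (b + 1) x + k (a + 1) x * k b x)
    (fun x hx => ((h.deriv a x hx).mul (h.deriv b x hx)).congr_deriv (by ring)) (by fun_prop)
  rw [wint_add h.cont (by fun_prop) (by fun_prop)] at h1
  have hb : k a 1 * k b 1 = 0 ∧ k a (-1) * k b (-1) = 0 := by
    rcases Nat.even_or_odd a with hev | hod
    · have hbo : Odd b := by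
        rcases Nat.even_or_odd b with h' | h'
        · exact absurd hab (by simpa using hev.add h')
        · exact h'
      simp [ho b hbo]
    · simp [ho a hod]
  rw [hb.1, hb.2] at h1
  linarith

/-- Parity is right for all n integrations by parts. The case of large n turns the leading term of
the flow into a signed energy. -/
lemma wint_mul_add_two_mul (h : ArcTower v k) (ho : OddVanish k) (n a : ℕ) :
    wint v (fun x => k a x * k (a + 2 * n) x) = (-1) ^ n * energy v k (a + n) := by
  induction n generalizing a with
  | zero => simp [energy, sq]
  | succ n ih =>
    have h1 := h.wint_mul_succ ho (a := a) (b := a + 2 * n + 1) ⟨a + n, by ring⟩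
    have h2 := ih (a + 1)
    rw [show a + 1 + 2 * n = a + 2 * n + 1 by ring, show a + 1 + n = a + (n + 1) by ring] at h2
    rw [show a + 2 * (n + 1) = a + 2 * n + 1 + 1 by ring, h1, h2]
    ring

lemma quad_succ (h : ArcTower v k) (ho : OddVanish k) {a b c d : ℕ} (hs : Odd (a + b + c + d)) :
    quad v k a b c (d + 1)
      = -(quad v k (a + 1) b c d + quad v k a (b + 1) c d + quad v k a b (c + 1) d) := by
  have ca := h.continuousOn a
  have cb := h.continuousOn b
  have cc := h.continuousOn c
  have cd := h.continuousOn d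
  have ca' := h.continuousOn (a + 1)
  have cb' := h.continuousOn (b + 1)
  have cc' := h.continuousOn (c + 1)
  have cd' := h.continuousOn (d + 1)
  have h1 := wint_deriv h.cont (f := fun x => k a x * k b x * k c x * k d x)
    (g := fun x => ((k a x * k b x * k c x * k (d + 1) x + k (a + 1) x * k b x * k c x * k d x)
      + k a x * k (b + 1) x * k c x * k d x) + k a x * k b x * k (c + 1) x * k d x)
    (fun x hx => ((((h.deriv a x hx).mul (h.deriv b x hx)).mul (h.deriv c x hx)).mul
      (h.deriv d x hx)).congr_deriv (by simp only [Pi.mul_apply]; ring)) (by fun_prop)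
  rw [wint_add h.cont (by fun_prop) (by fun_prop), wint_add h.cont (by fun_prop) (by fun_prop),
    wint_add h.cont (by fun_prop) (by fun_prop)] at h1
  have hb : k a 1 * k b 1 * k c 1 * k d 1 = 0
      ∧ k a (-1) * k b (-1) * k c (-1) * k d (-1) = 0 := by
    have : Odd a ∨ Odd b ∨ Odd c ∨ Odd d := by
      by_contra! hne
      simp only [Nat.not_odd_iff_even] at hne
      exact (Nat.not_odd_iff_even.2 (((hne.1.add hne.2.1).add hne.2.2.1).add hne.2.2.2)) hs
    rcases this with h' | h' | h' | h' <;> simp [ho _ h']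
  rw [hb.1, hb.2] at h1
  unfold quad
  linarith

/-! ### Poincaré, supremum and interpolation inequalities. -/

/-- Odd orders vanish at the ends. Even orders have mean zero: for order 0 by hypothesis, otherwise
as derivatives of an odd-order function vanishing at both ends. -/
lemma exists_zero (h : ArcTower v k) (ho : OddVanish k) (hm : wint v (k 0) = 0) (j : ℕ) :
    ∃ z ∈ paramInterval, k j z = 0 := by
  rcases Nat.even_or_odd j with hev | hod
  · refine exists_zero_of_wint_eq_zero h.cont h.pos (h.continuousOn j) ?_
    rcases j with _ | j
    · exact hm
    · have hj : Odd j := by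
        rcases Nat.even_or_odd j with h' | h'
        · exact absurd hev (by simpa using h'.add_one)
        · exact h'
      rw [h.wint_succ, (ho j hj).1, (ho j hj).2, sub_zero]
  · exact ⟨1, by simp, (ho j hod).2⟩

lemma sq_le_length_mul_energy (h : ArcTower v k) (ho : OddVanish k) (hm : wint v (k 0) = 0)
    (j : ℕ) {x : ℝ} (hx : x ∈ paramInterval) :
    k j x ^ 2 ≤ wint v (fun _ => 1) * energy v k (j + 1) := by
  obtain ⟨z, hz, hz0⟩ := h.exists_zero ho hm j
  have c1 := h.continuousOn (j + 1)
  have h1 := abs_le_wint_of_zero h.cont h.pos (h.deriv j) c1 hz hz0 hx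
  have h2 := wint_mul_sq_le h.cont h.pos (f := fun _ => 1) (g := fun y => |k (j + 1) y|)
    continuousOn_const c1.abs
  simp only [one_pow, one_mul, sq_abs] at h2
  calc k j x ^ 2 = |k j x| ^ 2 := (sq_abs _).symm
    _ ≤ _ := pow_le_pow_left₀ (abs_nonneg _) h1 2
    _ ≤ _ := h2

/-- The square of `k j` has arclength derivative 2 k_j k_{j+1}, to which Cauchy–Schwarz applies. No
factor of the length enters. -/
lemma pow_four_le (h : ArcTower v k) (ho : OddVanish k) (hm : wint v (k 0) = 0)
    (j : ℕ) {x : ℝ} (hx : x ∈ paramInterval) :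
    |k j x| ^ 4 ≤ 4 * (energy v k j * energy v k (j + 1)) := by
  obtain ⟨z, hz, hz0⟩ := h.exists_zero ho hm j
  have c0 := h.continuousOn j
  have c1 := h.continuousOn (j + 1)
  have h1 := abs_le_wint_of_zero h.cont h.pos (f := fun y => k j y ^ 2)
    (g := fun y => 2 * (k j y * k (j + 1) y))
    (fun y hy => ((h.deriv j y hy).pow 2).congr_deriv (by simp; ring)) (by fun_prop) hz
    (by simp [hz0]) hx
  have h2 := wint_mul_sq_le h.cont h.pos (f := fun y => |k j y|) (g := fun y => |k (j + 1) y|)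
    c0.abs c1.abs
  simp only [sq_abs] at h2
  have h3 : wint v (fun y => |2 * (k j y * k (j + 1) y)|)
      = 2 * wint v (fun y => |k j y| * |k (j + 1) y|) := by
    rw [← wint_const_mul]
    exact wint_congr fun y _ => by simp [abs_mul]
  rw [h3] at h1
  calc |k j x| ^ 4 = |k j x ^ 2| ^ 2 := by rw [abs_pow]; ring
    _ ≤ (2 * wint v (fun y => |k j y| * |k (j + 1) y|)) ^ 2 :=
      pow_le_pow_left₀ (abs_nonneg _) h1 2
    _ = 4 * wint v (fun y => |k j y| * |k (j + 1) y|) ^ 2 := by ring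
    _ ≤ _ := by unfold energy; linarith

lemma energy_le_length_sq_mul (h : ArcTower v k) (ho : OddVanish k) (hm : wint v (k 0) = 0)
    (j : ℕ) : energy v k j ≤ wint v (fun _ => 1) ^ 2 * energy v k (j + 1) := by
  have c0 := h.continuousOn j
  calc energy v k j
      ≤ wint v (fun _ => wint v (fun _ => 1) * energy v k (j + 1) * 1) :=
        wint_mono h.cont h.pos (by fun_prop) continuousOn_const
          fun x hx => (h.sq_le_length_mul_energy ho hm j hx).trans_eq (mul_one _).symm
    _ = _ := by rw [wint_const_mul]; ring

lemma energy_le_length_pow_mul (h : ArcTower v k) (ho : OddVanish k) (hm : wint v (k 0) = 0)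
    (j i : ℕ) : energy v k j ≤ wint v (fun _ => 1) ^ (2 * i) * energy v k (j + i) := by
  induction i with
  | zero => simp
  | succ i ih =>
    refine ih.trans ?_
    calc _ ≤ wint v (fun _ => 1) ^ (2 * i)
          * (wint v (fun _ => 1) ^ 2 * energy v k (j + i + 1)) :=
        mul_le_mul_of_nonneg_left (h.energy_le_length_sq_mul ho hm _)
          (pow_nonneg h.wint_one_pos.le _)
      _ = _ := by rw [← add_assoc]; ring

/-- Integration by parts gives E_{j+1} = -∫ k_j k_{j+2} ds; then Cauchy–Schwarz. -/
lemma energy_logConvex (h : ArcTower v k) (ho : OddVanish k) (j : ℕ) :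
    energy v k (j + 1) ^ 2 ≤ energy v k j * energy v k (j + 2) := by
  have h1 := h.wint_mul_succ ho (a := j) (b := j + 1) ⟨j, by ring⟩
  have h2 := wint_mul_sq_le h.cont h.pos (h.continuousOn j) (h.continuousOn (j + 2))
  rw [show j + 1 + 1 = j + 2 from rfl] at h1
  rw [h1, neg_sq] at h2
  refine le_trans (le_of_eq ?_) h2
  simp only [energy, sq]

lemma energy_interpolation (h : ArcTower v k) (ho : OddVanish k) {j i N : ℕ} (hN : j + i = N) :
    energy v k j ^ N ≤ energy v k 0 ^ i * energy v k N ^ j := by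
  subst hN
  exact pow_le_of_logConvex h.energy_nonneg (h.energy_logConvex ho) j i

/-! ### Quartic integrals. -/

/-- The size of a quartic integral of total order `2 M`, when `a, b, c ≤ M`, `d ≤ M + 1`. -/
lemma quad_pow_le_of_le (h : ArcTower v k) (ho : OddVanish k) (hm : wint v (k 0) = 0)
    {M a b c d : ℕ} (hs : a + b + c + d = 2 * M) (ha : a ≤ M) (hb : b ≤ M) (hc : c ≤ M)
    (hd : d ≤ M + 1) :
    (|quad v k a b c d| ^ 4) ^ (M + 1)
      ≤ 16 ^ (M + 1) * (energy v k 0 ^ (4 * M + 6) * energy v k (M + 1) ^ (4 * M + 2)) := by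
  have ca := h.continuousOn a
  have cb := h.continuousOn b
  have cc := h.continuousOn c
  have cd := h.continuousOn d
  -- Two factors are taken in supremum norm and two in L². Only the supremum norms cost an extra
  -- derivative, so d may equal M + 1.
  obtain ⟨xa, hxa, hxa'⟩ := isCompact_Icc.exists_isMaxOn (nonempty_Icc.2 (by norm_num)) ca.abs
  obtain ⟨xb, hxb, hxb'⟩ := isCompact_Icc.exists_isMaxOn (nonempty_Icc.2 (by norm_num)) cb.abs
  set α := |k a xa|
  set β := |k b xb|
  have hα := h.pow_four_le ho hm a hxa
  have hβ := h.pow_four_le ho hm b hxb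
  set I := wint v (fun x => |k c x| * |k d x|)
  have hI0 : 0 ≤ I := wint_nonneg h.pos fun x _ => by positivity
  have hI : I ^ 2 ≤ energy v k c * energy v k d := by
    simpa [energy] using wint_mul_sq_le h.cont h.pos cc.abs cd.abs
  have hQ : |quad v k a b c d| ≤ α * β * I := by
    refine (abs_wint_le h.cont h.pos (by fun_prop)).trans ?_
    rw [← wint_const_mul]
    refine wint_mono h.cont h.pos (by fun_prop) (by fun_prop) fun x hx => ?_
    have e1 : |k a x| ≤ α := hxa' hx
    have e2 : |k b x| ≤ β := hxb' hx
    rw [abs_mul, abs_mul, abs_mul, mul_assoc]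
    gcongr
  have hA := h.energy_nonneg
  obtain ⟨a', ha'⟩ := Nat.exists_eq_add_of_le ha
  obtain ⟨b', hb'⟩ := Nat.exists_eq_add_of_le hb
  obtain ⟨c', hc'⟩ := Nat.exists_eq_add_of_le hc
  obtain ⟨d', hd'⟩ := Nat.exists_eq_add_of_le hd
  have i1 := h.energy_interpolation ho (j := a) (i := a' + 1) (N := M + 1) (by omega)
  have i2 := h.energy_interpolation ho (j := a + 1) (i := a') (N := M + 1) (by omega)
  have i3 := h.energy_interpolation ho (j := b) (i := b' + 1) (N := M + 1) (by omega)
  have i4 := h.energy_interpolation ho (j := b + 1) (i := b') (N := M + 1) (by omega)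
  have i5 := h.energy_interpolation ho (j := c) (i := c' + 1) (N := M + 1) (by omega)
  have i6 := h.energy_interpolation ho (j := d) (i := d') (N := M + 1) (by omega)
  have n0 := hA 0
  have nN := hA (M + 1)
  have na := hA a
  have na1 := hA (a + 1)
  have nb := hA b
  have nb1 := hA (b + 1)
  have nc := hA c
  have nd := hA d
  -- The fourth power clears the roots in the supremum and Cauchy–Schwarz bounds; the power M + 1
  -- clears the interpolation exponents.
  calc (|quad v k a b c d| ^ 4) ^ (M + 1)
      ≤ ((α * β * I) ^ 4) ^ (M + 1) := by gcongr
    _ = (α ^ 4 * β ^ 4 * (I ^ 2) ^ 2) ^ (M + 1) := by ring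
    _ ≤ ((4 * (energy v k a * energy v k (a + 1))) * (4 * (energy v k b * energy v k (b + 1)))
          * (energy v k c * energy v k d) ^ 2) ^ (M + 1) := by gcongr
    _ = 16 ^ (M + 1) * (energy v k a ^ (M + 1) * energy v k (a + 1) ^ (M + 1)
          * (energy v k b ^ (M + 1) * energy v k (b + 1) ^ (M + 1))
          * (energy v k c ^ (M + 1) * energy v k d ^ (M + 1)) ^ 2) := by
        rw [show (16 : ℝ) = 4 * 4 by norm_num]
        simp only [mul_pow]
        ring
    _ ≤ 16 ^ (M + 1) * ((energy v k 0 ^ (a' + 1) * energy v k (M + 1) ^ a)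
          * (energy v k 0 ^ a' * energy v k (M + 1) ^ (a + 1))
          * ((energy v k 0 ^ (b' + 1) * energy v k (M + 1) ^ b)
          * (energy v k 0 ^ b' * energy v k (M + 1) ^ (b + 1)))
          * ((energy v k 0 ^ (c' + 1) * energy v k (M + 1) ^ c)
          * (energy v k 0 ^ d' * energy v k (M + 1) ^ d)) ^ 2) := by gcongr
    _ = 16 ^ (M + 1) * (energy v k 0 ^ (2 * a' + 2 * b' + 2 * c' + 2 * d' + 4)
          * energy v k (M + 1) ^ (2 * (a + b + c + d) + 2)) := by ring
    _ = _ := by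
        rw [show 2 * a' + 2 * b' + 2 * c' + 2 * d' + 4 = 4 * M + 6 by omega,
          show 2 * (a + b + c + d) + 2 = 4 * M + 2 by omega]

/-- A bound for all quartic integrals of total order `2 M` up to a combinatorial factor. -/
def QuarticBound (v : ℝ → ℝ) (k : ℕ → ℝ → ℝ) (M : ℕ) (S : ℝ) : Prop :=
  0 ≤ S ∧ S ^ (2 * (M + 1))
    = 4 ^ (M + 1) * (energy v k 0 ^ (2 * M + 3) * energy v k (M + 1) ^ (2 * M + 1))

/-- S is the root of order 2(M + 1). Specifying it by its power keeps fractional exponents out of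
later estimates. -/
lemma exists_quarticBound (h : ArcTower v k) (M : ℕ) : ∃ S, QuarticBound v k M S := by
  have h0 : 0 ≤ 4 ^ (M + 1) * (energy v k 0 ^ (2 * M + 3) * energy v k (M + 1) ^ (2 * M + 1)) :=
    mul_nonneg (by positivity) (mul_nonneg (pow_nonneg (h.energy_nonneg _) _)
      (pow_nonneg (h.energy_nonneg _) _))
  exact ⟨_, Real.rpow_nonneg h0 _, Real.rpow_inv_natCast_pow h0 (by omega)⟩

lemma abs_quad_le_of_le_succ (h : ArcTower v k) (ho : OddVanish k) (hm : wint v (k 0) = 0)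
    {M a b c d : ℕ} {S : ℝ} (hS : QuarticBound v k M S) (hs : a + b + c + d = 2 * M)
    (ha : a ≤ M) (hb : b ≤ M) (hc : c ≤ M) (hd : d ≤ M + 1) : |quad v k a b c d| ≤ S := by
  have h1 := h.quad_pow_le_of_le ho hm hs ha hb hc hd
  have h2 : (|quad v k a b c d| ^ 4) ^ (M + 1) ≤ (S ^ 4) ^ (M + 1) := by
    refine h1.trans (le_of_eq ?_)
    rw [show (S ^ 4) ^ (M + 1) = (S ^ (2 * (M + 1))) ^ 2 by ring, hS.2,
      show (16 : ℝ) = 4 * 4 by norm_num, mul_pow (4 : ℝ) 4]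
    ring
  have h3 := (pow_le_pow_iff_left₀ (by positivity) (pow_nonneg hS.1 4) (by omega)).1 h2
  exact (pow_le_pow_iff_left₀ (abs_nonneg _) hS.1 (by omega)).1 h3

lemma abs_quad_le_of_le (h : ArcTower v k) (ho : OddVanish k) (hm : wint v (k 0) = 0)
    {M : ℕ} {S : ℝ} (hS : QuarticBound v k M S) (d : ℕ) :
    ∀ a b c : ℕ, a + b + c + d = 2 * M → a ≤ M → b ≤ M → c ≤ M →
      |quad v k a b c d| ≤ 3 ^ d * S := by
  induction d with
  | zero =>
    intro a b c hs ha hb hc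
    simpa using h.abs_quad_le_of_le_succ ho hm hS hs ha hb hc (by omega)
  | succ d ih =>
    intro a b c hs ha hb hc
    rcases le_or_gt (d + 1) (M + 1) with hd | hd
    · have h4 := h.abs_quad_le_of_le_succ ho hm hS hs ha hb hc hd
      exact h4.trans (le_mul_of_one_le_left hS.1 (one_le_pow₀ (by norm_num)))
    -- Here d ≥ M + 1, so a, b, c are small enough to be raised by one. Each integration by parts
    -- produces three terms, hence the factor 3^d.
    · rw [h.quad_succ ho ⟨M - 1, by omega⟩, abs_neg]
      have e1 := ih (a + 1) b c (by omega) (by omega) hb hc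
      have e2 := ih a (b + 1) c (by omega) ha (by omega) hc
      have e3 := ih a b (c + 1) (by omega) ha hb (by omega)
      calc _ ≤ |quad v k (a + 1) b c d| + |quad v k a (b + 1) c d| + |quad v k a b (c + 1) d| :=
            abs_add_three _ _ _
        _ ≤ 3 ^ d * S + 3 ^ d * S + 3 ^ d * S := by gcongr
        _ = _ := by ring

/-- At most one of four indices with sum 2M exceeds M; symmetry moves it to the last place. -/
lemma abs_quad_le (h : ArcTower v k) (ho : OddVanish k) (hm : wint v (k 0) = 0)
    {M : ℕ} {S : ℝ} (hS : QuarticBound v k M S) {a b c d : ℕ} (hs : a + b + c + d = 2 * M) :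
    |quad v k a b c d| ≤ 3 ^ (2 * M) * S := by
  have mono : ∀ e, e ≤ 2 * M → (3 : ℝ) ^ e * S ≤ 3 ^ (2 * M) * S := fun e he =>
    mul_le_mul_of_nonneg_right (pow_le_pow_right₀ (by norm_num) he) hS.1
  by_cases ha : a ≤ M
  · by_cases hb : b ≤ M
    · by_cases hc : c ≤ M
      · exact (h.abs_quad_le_of_le ho hm hS d a b c hs ha hb hc).trans (mono _ (by omega))
      · rw [quad_swap_right]
        exact (h.abs_quad_le_of_le ho hm hS c a b d (by omega) ha hb (by omega)).trans
          (mono _ (by omega))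
    · rw [quad_swap_mid]
      exact (h.abs_quad_le_of_le ho hm hS b a d c (by omega) ha (by omega) (by omega)).trans
        (mono _ (by omega))
  · rw [quad_swap_outer]
    exact (h.abs_quad_le_of_le ho hm hS a d b c (by omega) (by omega) (by omega)
      (by omega)).trans (mono _ (by omega))

/-- One of the 2M + 3 factors E_0 is traded for L^{2(M+1)} E_{M+1} by Poincaré, leaving a full power
of L E_0. -/
lemma quarticBound_le_length (h : ArcTower v k) (ho : OddVanish k) (hm : wint v (k 0) = 0)
    {M : ℕ} {S : ℝ} (hS : QuarticBound v k M S) :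
    S ≤ 2 * (wint v (fun _ => 1) * energy v k 0) * energy v k (M + 1) := by
  have hL := h.wint_one_pos.le
  have n0 := h.energy_nonneg 0
  have nN := h.energy_nonneg (M + 1)
  have hP := h.energy_le_length_pow_mul ho hm 0 (M + 1)
  rw [zero_add] at hP
  refine (pow_le_pow_iff_left₀ hS.1 (by positivity) (n := 2 * (M + 1)) (by omega)).1 ?_
  rw [hS.2]
  set L := wint v (fun _ => 1)
  calc 4 ^ (M + 1) * (energy v k 0 ^ (2 * M + 3) * energy v k (M + 1) ^ (2 * M + 1))
      = 4 ^ (M + 1) * (energy v k 0 ^ (2 * M + 2) * energy v k 0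
          * energy v k (M + 1) ^ (2 * M + 1)) := by ring
    _ ≤ 4 ^ (M + 1) * (energy v k 0 ^ (2 * M + 2) * (L ^ (2 * (M + 1)) * energy v k (M + 1))
          * energy v k (M + 1) ^ (2 * M + 1)) := by gcongr
    _ = _ := by
      rw [show (4 : ℝ) = 2 ^ 2 by norm_num]
      simp only [mul_pow, ← pow_mul]
      ring

/-- A Young inequality. Either S ≤ η E_{M+1}, or E_{M+1} < S/η can be inserted into the equation
defining S and S^{2M+1} cancelled. -/
lemma quarticBound_le_add (h : ArcTower v k)
    {M : ℕ} {S η : ℝ} (hS : QuarticBound v k M S) (hη : 0 < η) :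
    S ≤ η * energy v k (M + 1)
      + 4 ^ (M + 1) * η⁻¹ ^ (2 * M + 1) * energy v k 0 ^ (2 * M + 3) := by
  have n0 := h.energy_nonneg 0
  have nN := h.energy_nonneg (M + 1)
  rcases le_or_gt S (η * energy v k (M + 1)) with hc | hc
  · exact hc.trans (le_add_of_nonneg_right (by positivity))
  · refine le_trans ?_ (le_add_of_nonneg_left (by positivity))
    have hS0 : 0 < S := lt_of_le_of_lt (by positivity) hc
    have hc' : energy v k (M + 1) ≤ η⁻¹ * S := by
      rw [inv_mul_eq_div, le_div_iff₀ hη, mul_comm]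
      exact hc.le
    have h1 : S ^ (2 * M + 1) * S
        ≤ S ^ (2 * M + 1) * (4 ^ (M + 1) * η⁻¹ ^ (2 * M + 1) * energy v k 0 ^ (2 * M + 3)) := by
      calc S ^ (2 * M + 1) * S = S ^ (2 * (M + 1)) := by ring
        _ = 4 ^ (M + 1) * (energy v k 0 ^ (2 * M + 3) * energy v k (M + 1) ^ (2 * M + 1)) := hS.2
        _ ≤ 4 ^ (M + 1) * (energy v k 0 ^ (2 * M + 3) * (η⁻¹ * S) ^ (2 * M + 1)) := by gcongr
        _ = _ := by rw [mul_pow]; ring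
    exact le_of_mul_le_mul_left h1 (by positivity)

end ArcTower

/-! ### Calculus on a space-time rectangle -/

section spacetime

variable {E : Type*} [NormedAddCommGroup E] [NormedSpace ℝ E] {I : Set ℝ}

/-- Space-time derivative in time, within the time interval `I`. -/
def dt (I : Set ℝ) (f : ℝ → ℝ → E) (t x : ℝ) : E := derivWithin (fun r => f r x) I t

/-- Space-time derivative in the parameter. -/
def dx (f : ℝ → ℝ → E) (t x : ℝ) : E := derivWithin (f t) paramInterval x

/-- Smoothness up to the boundary on `I × [-1, 1]`. -/
def SmoothST (I : Set ℝ) (f : ℝ → ℝ → E) : Prop :=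
  ContDiffOn ℝ ∞ (fun p : ℝ × ℝ => f p.1 p.2) (I ×ˢ paramInterval)

/-- A convex set of times with interior points. -/
def IsTimeSet (I : Set ℝ) : Prop := Convex ℝ I ∧ (interior I).Nonempty

lemma uniqueDiffOn_param : UniqueDiffOn ℝ paramInterval := uniqueDiffOn_Icc (by norm_num)

lemma IsTimeSet.uniqueDiffOn (hI : IsTimeSet I) : UniqueDiffOn ℝ I :=
  uniqueDiffOn_convex hI.1 hI.2

lemma IsTimeSet.uniqueDiffOn_prod (hI : IsTimeSet I) : UniqueDiffOn ℝ (I ×ˢ paramInterval) :=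
  hI.uniqueDiffOn.prod uniqueDiffOn_param

/-- This is what makes second derivatives symmetric at boundary points, including t = 0 and x = ±1.
-/
lemma IsTimeSet.mem_closure_interior (hI : IsTimeSet I) {p : ℝ × ℝ}
    (hp : p ∈ I ×ˢ paramInterval) : p ∈ closure (interior (I ×ˢ paramInterval)) := by
  rw [interior_prod_eq, closure_prod_eq, hI.1.closure_interior_eq_closure_of_nonempty_interior hI.2,
    interior_Icc, closure_Ioo (by norm_num)]
  exact ⟨subset_closure hp.1, hp.2⟩

namespace SmoothST

variable {f g : ℝ → ℝ → E}

lemma congr (hf : SmoothST I f) (h : ∀ t ∈ I, ∀ x ∈ paramInterval, g t x = f t x) :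
    SmoothST I g :=
  ContDiffOn.congr hf fun p hp => h p.1 hp.1 p.2 hp.2

lemma continuousOn (hf : SmoothST I f) :
    ContinuousOn (fun p : ℝ × ℝ => f p.1 p.2) (I ×ˢ paramInterval) :=
  ContDiffOn.continuousOn hf

lemma continuousOn_param (hf : SmoothST I f) {t : ℝ} (ht : t ∈ I) :
    ContinuousOn (f t) paramInterval :=
  hf.continuousOn.comp (f := fun x => (t, x)) (by fun_prop) fun _ hx => ⟨ht, hx⟩

lemma hasFDerivWithinAt (hf : SmoothST I f) {t x : ℝ} (ht : t ∈ I) (hx : x ∈ paramInterval) :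
    HasFDerivWithinAt (fun p : ℝ × ℝ => f p.1 p.2)
      (fderivWithin ℝ (fun p : ℝ × ℝ => f p.1 p.2) (I ×ˢ paramInterval) (t, x))
      (I ×ˢ paramInterval) (t, x) :=
  (ContDiffOn.differentiableOn hf (by simp) (t, x) ⟨ht, hx⟩).hasFDerivWithinAt

lemma hasDerivWithinAt_dx_fderiv (hf : SmoothST I f) {t x : ℝ} (ht : t ∈ I)
    (hx : x ∈ paramInterval) :
    HasDerivWithinAt (f t) (fderivWithin ℝ (fun p : ℝ × ℝ => f p.1 p.2) (I ×ˢ paramInterval)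
      (t, x) (0, 1)) paramInterval x :=
  (hf.hasFDerivWithinAt ht hx).comp_hasDerivWithinAt x
    ((hasDerivWithinAt_const x _ t).prodMk (hasDerivWithinAt_id x _)) fun _ hy => ⟨ht, hy⟩

lemma hasDerivWithinAt_dt_fderiv (hf : SmoothST I f) {t x : ℝ} (ht : t ∈ I)
    (hx : x ∈ paramInterval) :
    HasDerivWithinAt (fun r => f r x) (fderivWithin ℝ (fun p : ℝ × ℝ => f p.1 p.2)
      (I ×ˢ paramInterval) (t, x) (1, 0)) I t :=
  (hf.hasFDerivWithinAt ht hx).comp_hasDerivWithinAt (f := fun r => (r, x)) t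
    ((hasDerivWithinAt_id t _).prodMk (hasDerivWithinAt_const t _ x)) fun _ hy => ⟨hy, hx⟩

lemma dx_eq (hf : SmoothST I f) {t x : ℝ} (ht : t ∈ I) (hx : x ∈ paramInterval) :
    dx f t x = fderivWithin ℝ (fun p : ℝ × ℝ => f p.1 p.2) (I ×ˢ paramInterval)
      (t, x) (0, 1) :=
  (hf.hasDerivWithinAt_dx_fderiv ht hx).derivWithin (uniqueDiffOn_param x hx)

lemma dt_eq (hf : SmoothST I f) (hI : IsTimeSet I) {t x : ℝ} (ht : t ∈ I)
    (hx : x ∈ paramInterval) :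
    dt I f t x = fderivWithin ℝ (fun p : ℝ × ℝ => f p.1 p.2)
      (I ×ˢ paramInterval) (t, x) (1, 0) :=
  (hf.hasDerivWithinAt_dt_fderiv ht hx).derivWithin (hI.uniqueDiffOn t ht)

lemma hasDerivWithinAt_dx (hf : SmoothST I f) {t x : ℝ} (ht : t ∈ I) (hx : x ∈ paramInterval) :
    HasDerivWithinAt (f t) (dx f t x) paramInterval x := by
  rw [hf.dx_eq ht hx]
  exact hf.hasDerivWithinAt_dx_fderiv ht hx

lemma hasDerivWithinAt_dt (hf : SmoothST I f) (hI : IsTimeSet I) {t x : ℝ} (ht : t ∈ I)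
    (hx : x ∈ paramInterval) :
    HasDerivWithinAt (fun r => f r x) (dt I f t x) I t := by
  rw [hf.dt_eq hI ht hx]
  exact hf.hasDerivWithinAt_dt_fderiv ht hx

lemma fderivWithin_apply (hf : SmoothST I f) (hI : IsTimeSet I) (w : ℝ × ℝ) :
    SmoothST I (fun t x => fderivWithin ℝ (fun p : ℝ × ℝ => f p.1 p.2) (I ×ˢ paramInterval)
      (t, x) w) :=
  (ContDiffOn.fderivWithin hf hI.uniqueDiffOn_prod (m := ∞) (by simp)).clm_apply contDiffOn_const

lemma smooth_dx (hf : SmoothST I f) (hI : IsTimeSet I) : SmoothST I (dx f) :=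
  (hf.fderivWithin_apply hI (0, 1)).congr fun _ ht _ hx => hf.dx_eq ht hx

lemma smooth_dt (hf : SmoothST I f) (hI : IsTimeSet I) : SmoothST I (dt I f) :=
  (hf.fderivWithin_apply hI (1, 0)).congr fun _ ht _ hx => hf.dt_eq hI ht hx

end SmoothST

lemma dx_congr {f g : ℝ → ℝ → E} {t x : ℝ} (h : ∀ y ∈ paramInterval, f t y = g t y)
    (hx : x ∈ paramInterval) : dx f t x = dx g t x :=
  derivWithin_congr h (h x hx)

lemma dt_congr {f g : ℝ → ℝ → E} {t x : ℝ} (h : ∀ r ∈ I, f r x = g r x)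
    (ht : t ∈ I) : dt I f t x = dt I g t x :=
  derivWithin_congr h (h t ht)

lemma SmoothST.dt_dx_comm {f : ℝ → ℝ → E} (hf : SmoothST I f) (hI : IsTimeSet I) {t x : ℝ}
    (ht : t ∈ I) (hx : x ∈ paramInterval) :
    dt I (dx f) t x = dx (dt I f) t x := by
  have hU := hI.uniqueDiffOn_prod
  have hD : DifferentiableWithinAt ℝ
      (fderivWithin ℝ (fun p : ℝ × ℝ => f p.1 p.2) (I ×ˢ paramInterval))
      (I ×ˢ paramInterval) (t, x) :=
    (ContDiffOn.fderivWithin hf hU (m := ∞) (by simp)).differentiableOn (by simp) _ ⟨ht, hx⟩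
  have key : ∀ w w' : ℝ × ℝ, fderivWithin ℝ (fun p : ℝ × ℝ =>
      fderivWithin ℝ (fun p : ℝ × ℝ => f p.1 p.2) (I ×ˢ paramInterval) (p.1, p.2) w)
      (I ×ˢ paramInterval) (t, x) w' =
      fderivWithin ℝ (fderivWithin ℝ (fun p : ℝ × ℝ => f p.1 p.2) (I ×ˢ paramInterval))
        (I ×ˢ paramInterval) (t, x) w' w := by
    intro w w'
    have := (hD.hasFDerivWithinAt.clm_apply
      (hasFDerivWithinAt_const w (t, x) (I ×ˢ paramInterval))).fderivWithin (hU _ ⟨ht, hx⟩)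
    simp only [Prod.mk.eta]
    rw [this]
    simp
  have hsymm : IsSymmSndFDerivWithinAt ℝ (fun p : ℝ × ℝ => f p.1 p.2) (I ×ˢ paramInterval)
      (t, x) :=
    (ContDiffOn.contDiffWithinAt hf ⟨ht, hx⟩).isSymmSndFDerivWithinAt
      (by simpa using ENat.LEInfty.out) hU
      (hI.mem_closure_interior ⟨ht, hx⟩) ⟨ht, hx⟩
  rw [dt_congr (g := fun t x => fderivWithin ℝ (fun p : ℝ × ℝ => f p.1 p.2)
      (I ×ˢ paramInterval) (t, x) (0, 1)) (fun r hr => hf.dx_eq hr hx) ht,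
    dx_congr (g := fun t x => fderivWithin ℝ (fun p : ℝ × ℝ => f p.1 p.2)
      (I ×ˢ paramInterval) (t, x) (1, 0)) (fun y hy => hf.dt_eq hI ht hy) hx,
    (hf.fderivWithin_apply hI (0, 1)).dt_eq hI ht hx, (hf.fderivWithin_apply hI (1, 0)).dx_eq ht hx,
    key, key]
  exact hsymm _ _

end spacetime

/-! ### Integrals depending on time -/

lemma continuousOn_integral_param {I : Set ℝ} {f : ℝ → ℝ → ℝ}
    (hf : ContinuousOn (fun p : ℝ × ℝ => f p.1 p.2) (I ×ˢ paramInterval)) :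
    ContinuousOn (fun t => ∫ x in (-1 : ℝ)..1, f t x) I := by
  rw [continuousOn_iff_continuous_domRestrict]
  have h11 : (-1 : ℝ) ≤ 1 := by norm_num
  -- Continuity is known only over [-1, 1]; projecting x onto this interval extends the integrand
  -- without changing the integral.
  have h1 : Continuous (Function.uncurry fun (t : I) (x : ℝ) => f t (projIcc (-1) 1 h11 x)) :=
    hf.comp_continuous (f := fun p : I × ℝ => ((p.1 : ℝ), (projIcc (-1) 1 h11 p.2 : ℝ)))
      (by fun_prop) fun p => ⟨p.1.2, (projIcc (-1) 1 h11 p.2).2⟩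
  convert! intervalIntegral.continuous_parametric_intervalIntegral_of_continuous'
    (μ := volume) h1 (-1) 1 using 2 with t
  refine intervalIntegral.integral_congr fun x hx => ?_
  rw [uIcc_param] at hx
  simp only [projIcc_of_mem h11 hx]

/-- The time derivative is bounded on a compact neighbourhood of t, which dominates the difference
quotients. -/
lemma SmoothST.hasDerivAt_integral {I : Set ℝ} {f : ℝ → ℝ → ℝ} (hf : SmoothST I f)
    (hI : IsTimeSet I) {t : ℝ} (ht : t ∈ interior I) :
    HasDerivAt (fun r => ∫ x in (-1 : ℝ)..1, f r x) (∫ x in (-1 : ℝ)..1, dt I f t x) t := by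
  obtain ⟨ρ, hρ, hball⟩ := Metric.isOpen_iff.1 isOpen_interior t ht
  have hsub : Metric.closedBall t (ρ / 2) ⊆ interior I :=
    (Metric.closedBall_subset_ball (by linarith)).trans hball
  have hIoc : uIoc (-1 : ℝ) 1 ⊆ paramInterval := by
    rw [uIoc_of_le (by norm_num)]
    exact Ioc_subset_Icc_self
  obtain ⟨B, hB⟩ := ((isCompact_closedBall t (ρ / 2)).prod
    (isCompact_Icc (a := (-1 : ℝ)) (b := 1))).exists_bound_of_continuousOn
    ((hf.smooth_dt hI).continuousOn.mono (prod_mono (hsub.trans interior_subset) Subset.rfl))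
  have hmem : ∀ r ∈ Metric.ball t (ρ / 2), r ∈ interior I := fun r hr =>
    hsub (Metric.ball_subset_closedBall hr)
  have hint : ∀ {g : ℝ → ℝ → ℝ}, SmoothST I g → ∀ r ∈ interior I,
      IntervalIntegrable (g r) volume (-1) 1 := fun hg r hr =>
    intervalIntegrable_of_continuousOn (hg.continuousOn_param (interior_subset hr))
  refine (intervalIntegral.hasDerivAt_integral_of_dominated_loc_of_deriv_le (F' := dt I f)
    (s := Metric.ball t (ρ / 2)) (bound := fun _ => B) (Metric.ball_mem_nhds _ (by linarith))
    ?_ (hint hf t ht) ?_ ?_ intervalIntegrable_const ?_).2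
  · filter_upwards [Metric.ball_mem_nhds t (half_pos hρ)] with r hr
    exact (hint hf r (hmem r hr)).def'.aestronglyMeasurable
  · exact (hint (hf.smooth_dt hI) t ht).def'.aestronglyMeasurable
  · exact Filter.Eventually.of_forall fun x hx r hr =>
      hB (r, x) ⟨Metric.ball_subset_closedBall hr, hIoc hx⟩
  · exact Filter.Eventually.of_forall fun x hx r hr =>
      (hf.hasDerivWithinAt_dt hI (interior_subset (hmem r hr)) (hIoc hx)).hasDerivAt
        (mem_interior_iff_mem_nhds.1 (hmem r hr))

/-! ### Plane geometry -/

lemma inner_plane (v w : Plane) : inner ℝ v w = v 0 * w 0 + v 1 * w 1 := by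
  simp [PiLp.inner_apply, Fin.sum_univ_two, mul_comm]

@[simp] lemma rot_apply_zero (v : Plane) : rot v 0 = -(v 1) := by simp [rot]

@[simp] lemma rot_apply_one (v : Plane) : rot v 1 = v 0 := by simp [rot]

lemma plane_ext {v w : Plane} (h0 : v 0 = w 0) (h1 : v 1 = w 1) : v = w := by
  ext i
  fin_cases i <;> assumption

/-- The rotation as a continuous linear map. -/
def rotL : Plane →L[ℝ] Plane :=
  LinearMap.toContinuousLinearMap
    { toFun := rot
      map_add' := fun v w => plane_ext (by simp; ring) (by simp)
      map_smul' := fun c v => plane_ext (by simp) (by simp) }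

@[simp] lemma rotL_apply (v : Plane) : rotL v = rot v := rfl

lemma rot_smul (c : ℝ) (v : Plane) : rot (c • v) = c • rot v := rotL.map_smul c v

lemma rot_rot (v : Plane) : rot (rot v) = -v := plane_ext (by simp) (by simp)

lemma inner_rot_self (v : Plane) : inner ℝ v (rot v) = 0 := by
  rw [inner_plane]; simp; ring

lemma inner_rot_rot (v w : Plane) : inner ℝ (rot v) (rot w) = inner ℝ v w := by
  rw [inner_plane, inner_plane]; simp; ring

lemma eq_smul_rot_of_inner_eq_zero {u w : Plane} (hu : inner ℝ u u = 1)
    (h : inner ℝ w u = 0) : w = (inner ℝ w (rot u) : ℝ) • rot u := by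
  rw [inner_plane] at hu h
  refine plane_ext ?_ ?_ <;>
    simp only [PiLp.smul_apply, smul_eq_mul, rot_apply_zero, rot_apply_one, inner_plane]
  · linear_combination (-(w 0)) * hu + u 0 * h
  · linear_combination (-(w 1)) * hu + u 1 * h

/-- In the plane ⟨u, e⟩² + ⟨u, rot e⟩² = |u|² |e|², so the two products cannot both vanish. -/
lemma inner_rot_ne_zero {u e : Plane} (hu : inner ℝ u u = 1) (he : ‖e‖ = 1)
    (h : inner ℝ u (rot e) = 0) : (inner ℝ (rot u) (rot e) : ℝ) ≠ 0 := by
  have he' : inner ℝ e e = (1 : ℝ) := by rw [real_inner_self_eq_norm_sq, he, one_pow]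
  rw [inner_rot_rot]
  rw [inner_plane] at hu he' h ⊢
  simp only [rot_apply_zero, rot_apply_one] at h
  intro hc
  have : (u 0 * u 0 + u 1 * u 1) * (e 0 * e 0 + e 1 * e 1) = 0 := by
    linear_combination (u 0 * e 0 + u 1 * e 1) * hc + (u 0 * -e 1 + u 1 * e 0) * h
  rw [hu, he'] at this
  norm_num at this

/-! ### Geometry of a smooth family of curves -/

section family

variable {E : Type*} [NormedAddCommGroup E] [NormedSpace ℝ E]

/-- The arclength derivative of a function along a family of curves. -/
def ds (γ : ℝ → ℝ → Plane) (f : ℝ → ℝ → E) (t x : ℝ) : E := arcDeriv (γ t) (f t) x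

/-- The `ℓ`-th arclength derivative of the curvature of a family of curves. -/
def curv (γ : ℝ → ℝ → Plane) (ℓ : ℕ) (t x : ℝ) : ℝ := curvatureDeriv (γ t) ℓ x

lemma curv_succ (γ : ℝ → ℝ → Plane) (ℓ : ℕ) : curv γ (ℓ + 1) = ds γ (curv γ ℓ) := by
  funext t x
  simp only [curv, ds, curvatureDeriv, Function.iterate_succ_apply']
  rfl

/-- A smooth family of immersed curves. -/
structure SmoothFamily (I : Set ℝ) (γ : ℝ → ℝ → Plane) : Prop where
  time : IsTimeSet I
  smooth : SmoothST I γ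
  immersed : ∀ t ∈ I, ∀ x ∈ paramInterval, velocity (γ t) x ≠ 0

namespace SmoothFamily

variable {I : Set ℝ} {γ : ℝ → ℝ → Plane} {t x : ℝ}

lemma speed_pos (h : SmoothFamily I γ) (ht : t ∈ I) (hx : x ∈ paramInterval) :
    0 < speed (γ t) x := norm_pos_iff.2 (h.immersed t ht x hx)

lemma smooth_velocity (h : SmoothFamily I γ) : SmoothST I (fun t x => velocity (γ t) x) :=
  h.smooth.smooth_dx h.time

lemma smooth_speed (h : SmoothFamily I γ) : SmoothST I (fun t x => speed (γ t) x) :=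
  ContDiffOn.norm ℝ h.smooth_velocity fun p hp => h.immersed p.1 hp.1 p.2 hp.2

lemma smooth_ds (h : SmoothFamily I γ) {f : ℝ → ℝ → E} (hf : SmoothST I f) :
    SmoothST I (ds γ f) :=
  ContDiffOn.smul (ContDiffOn.inv h.smooth_speed fun _ hp => (h.speed_pos hp.1 hp.2).ne')
    (hf.smooth_dx h.time)

lemma smooth_tangent (h : SmoothFamily I γ) : SmoothST I (fun t x => tangent (γ t) x) :=
  h.smooth_ds h.smooth

lemma smooth_normal (h : SmoothFamily I γ) : SmoothST I (fun t x => normal (γ t) x) :=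
  rotL.contDiff.comp_contDiffOn h.smooth_tangent

lemma smooth_curv (h : SmoothFamily I γ) (ℓ : ℕ) : SmoothST I (curv γ ℓ) := by
  induction ℓ with
  | zero => exact ContDiffOn.inner ℝ (h.smooth_ds h.smooth_tangent) h.smooth_normal
  | succ ℓ ih =>
    rw [curv_succ]
    exact h.smooth_ds ih

lemma speed_smul_ds (h : SmoothFamily I γ) (f : ℝ → ℝ → E) (ht : t ∈ I)
    (hx : x ∈ paramInterval) : speed (γ t) x • ds γ f t x = dx f t x := by
  simp only [ds, arcDeriv, dx]
  rw [smul_inv_smul₀ (h.speed_pos ht hx).ne']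

lemma hasDerivWithinAt_ds (h : SmoothFamily I γ) {f : ℝ → ℝ → E} (hf : SmoothST I f)
    (ht : t ∈ I) (hx : x ∈ paramInterval) :
    HasDerivWithinAt (f t) (speed (γ t) x • ds γ f t x) paramInterval x := by
  rw [h.speed_smul_ds f ht hx]
  exact hf.hasDerivWithinAt_dx ht hx

lemma ds_eq (h : SmoothFamily I γ) {f : ℝ → ℝ → E} {w : E} (ht : t ∈ I) (hx : x ∈ paramInterval)
    (hd : HasDerivWithinAt (f t) (speed (γ t) x • w) paramInterval x) : ds γ f t x = w := by
  simp only [ds, arcDeriv]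
  rw [hd.derivWithin (uniqueDiffOn_param x hx), inv_smul_smul₀ (h.speed_pos ht hx).ne']

lemma velocity_eq (h : SmoothFamily I γ) (ht : t ∈ I) (hx : x ∈ paramInterval) :
    velocity (γ t) x = speed (γ t) x • tangent (γ t) x :=
  (h.speed_smul_ds γ ht hx).symm

lemma inner_tangent_self (h : SmoothFamily I γ) (ht : t ∈ I) (hx : x ∈ paramInterval) :
    inner ℝ (tangent (γ t) x) (tangent (γ t) x) = (1 : ℝ) := by
  have h0 := (h.speed_pos ht hx).ne'
  have h1 : inner ℝ (velocity (γ t) x) (velocity (γ t) x) = speed (γ t) x ^ 2 :=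
    real_inner_self_eq_norm_sq _
  rw [h.velocity_eq ht hx, real_inner_smul_left, real_inner_smul_right] at h1
  have h2 : speed (γ t) x ^ 2 ≠ 0 := pow_ne_zero 2 h0
  apply mul_left_cancel₀ h2
  linear_combination h1

lemma inner_normal_self (h : SmoothFamily I γ) (ht : t ∈ I) (hx : x ∈ paramInterval) :
    inner ℝ (normal (γ t) x) (normal (γ t) x) = (1 : ℝ) := by
  rw [normal, inner_rot_rot, h.inner_tangent_self ht hx]

lemma inner_tangent_normal (γ : ℝ → ℝ → Plane) (t x : ℝ) :
    inner ℝ (tangent (γ t) x) (normal (γ t) x) = (0 : ℝ) := inner_rot_self _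

/-- Differentiating |τ|² = 1 shows that τ_s is normal, so its only component is the curvature. -/
lemma ds_tangent (h : SmoothFamily I γ) (ht : t ∈ I) (hx : x ∈ paramInterval) :
    ds γ (fun t x => tangent (γ t) x) t x = curv γ 0 t x • normal (γ t) x := by
  have hd := h.hasDerivWithinAt_ds h.smooth_tangent ht hx
  have h1 := (hd.inner ℝ hd).congr_of_mem (fun y hy => (h.inner_tangent_self ht hy).symm) hx
  have h2 := (uniqueDiffOn_param x hx).eq_deriv _ h1 (hasDerivWithinAt_const _ _ (1 : ℝ))
  rw [real_inner_smul_left, real_inner_smul_right, real_inner_comm] at h2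
  have h3 : inner ℝ (ds γ (fun t x => tangent (γ t) x) t x) (tangent (γ t) x) = (0 : ℝ) := by
    have h0 := (h.speed_pos ht hx).ne'
    apply mul_left_cancel₀ h0
    linarith
  exact eq_smul_rot_of_inner_eq_zero (h.inner_tangent_self ht hx) h3

lemma ds_smul_normal (h : SmoothFamily I γ) {F : ℝ → ℝ → ℝ} (hF : SmoothST I F) (ht : t ∈ I)
    (hx : x ∈ paramInterval) :
    ds γ (fun t x => F t x • normal (γ t) x) t x
      = ds γ F t x • normal (γ t) x - (F t x * curv γ 0 t x) • tangent (γ t) x := by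
  have hν : HasDerivWithinAt (fun y => normal (γ t) y)
      (speed (γ t) x • -(curv γ 0 t x • tangent (γ t) x)) paramInterval x := by
    refine (rotL.hasFDerivAt.comp_hasDerivWithinAt x
      (h.hasDerivWithinAt_ds h.smooth_tangent ht hx)).congr_deriv ?_
    rw [h.ds_tangent ht hx, rotL_apply, rot_smul, rot_smul, normal, rot_rot]
    module
  refine h.ds_eq ht hx (((h.hasDerivWithinAt_ds hF ht hx).smul hν).congr_deriv ?_)
  simp only [smul_eq_mul]
  module

/-- The arclength derivatives of the curvature at a fixed time. -/
lemma arcTower (h : SmoothFamily I γ) (ht : t ∈ I) :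
    ArcTower (speed (γ t)) (fun ℓ => curv γ ℓ t) where
  cont := h.smooth_speed.continuousOn_param ht
  pos := fun _ hx => h.speed_pos ht hx
  deriv := fun i x hx => by
    rw [curv_succ]
    exact h.hasDerivWithinAt_ds (h.smooth_curv i) ht hx

end SmoothFamily

/-- A smooth family of immersed curves that moves with normal velocity `F`. -/
structure NormalFlow (I : Set ℝ) (γ : ℝ → ℝ → Plane) (F : ℝ → ℝ → ℝ) : Prop
    extends SmoothFamily I γ where
  smooth_force : SmoothST I F
  flow : ∀ t ∈ I, ∀ x ∈ paramInterval, dt I γ t x = F t x • normal (γ t) x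

namespace NormalFlow

variable {I : Set ℝ} {γ : ℝ → ℝ → Plane} {F : ℝ → ℝ → ℝ} {t x : ℝ}

lemma dt_velocity (h : NormalFlow I γ F) (ht : t ∈ I) (hx : x ∈ paramInterval) :
    dt I (fun t x => velocity (γ t) x) t x = speed (γ t) x •
      (ds γ F t x • normal (γ t) x - (F t x * curv γ 0 t x) • tangent (γ t) x) := by
  have h1 := h.smooth.dt_dx_comm h.time ht hx
  rw [dx_congr (g := fun t x => F t x • normal (γ t) x) (fun y hy => h.flow t ht y hy) hx] at h1
  rw [← h.ds_smul_normal h.smooth_force ht hx, h.speed_smul_ds _ ht hx]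
  exact h1

/-- Differentiate |γ_x|² in time; only the tangential part -F k τ of the velocity derivative
contributes. -/
lemma dt_speed (h : NormalFlow I γ F) (ht : t ∈ I) (hx : x ∈ paramInterval) :
    dt I (fun t x => speed (γ t) x) t x = -(F t x * curv γ 0 t x * speed (γ t) x) := by
  have h0 := (h.speed_pos ht hx).ne'
  have h1 := h.smooth_velocity.hasDerivWithinAt_dt h.time ht hx
  have h2 := (h.smooth_speed.hasDerivWithinAt_dt h.time ht hx).pow 2
  have h3 := (h1.inner ℝ h1).congr_of_mem
    (fun r _ => (real_inner_self_eq_norm_sq (velocity (γ r) x)).symm) ht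
  have h4 := (h.time.uniqueDiffOn t ht).eq_deriv _ h2 h3
  rw [h.dt_velocity ht hx, h.velocity_eq ht hx] at h4
  simp only [real_inner_smul_left, real_inner_smul_right, inner_sub_left, inner_sub_right,
    h.inner_tangent_self ht hx, SmoothFamily.inner_tangent_normal,
    real_inner_comm (tangent (γ t) x) (normal (γ t) x)] at h4
  apply mul_left_cancel₀ h0
  norm_num at h4
  linarith

/-- The commutator of the time derivative and the arclength derivative. -/
lemma dt_ds (h : NormalFlow I γ F) {f : ℝ → ℝ → E} (hf : SmoothST I f) (ht : t ∈ I)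
    (hx : x ∈ paramInterval) :
    dt I (ds γ f) t x = ds γ (dt I f) t x + (F t x * curv γ 0 t x) • ds γ f t x := by
  have h0 := (h.speed_pos ht hx).ne'
  have h1 := (h.smooth_speed.hasDerivWithinAt_dt h.time ht hx).smul
    ((h.smooth_ds hf).hasDerivWithinAt_dt h.time ht hx)
  have h2 := h1.congr_of_mem (fun r hr => (h.speed_smul_ds f hr hx).symm) ht
  have h3 := (h.time.uniqueDiffOn t ht).eq_deriv _ h2
    ((hf.smooth_dx h.time).hasDerivWithinAt_dt h.time ht hx)
  rw [hf.dt_dx_comm h.time ht hx, ← h.speed_smul_ds _ ht hx, h.dt_speed ht hx] at h3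
  apply smul_right_injective _ h0
  simp only
  rw [smul_add, ← h3]
  module

lemma dt_tangent (h : NormalFlow I γ F) (ht : t ∈ I) (hx : x ∈ paramInterval) :
    dt I (fun t x => tangent (γ t) x) t x = ds γ F t x • normal (γ t) x := by
  have h1 := h.dt_ds h.smooth ht hx
  have h2 : ds γ (dt I γ) t x = ds γ (fun t x => F t x • normal (γ t) x) t x := by
    simp only [ds, arcDeriv]
    rw [derivWithin_congr (fun y hy => h.flow t ht y hy) (h.flow t ht x hx)]
  rw [h2, h.ds_smul_normal h.smooth_force ht hx] at h1
  refine h1.trans ?_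
  change _ + _ • tangent (γ t) x = _
  module

lemma dt_normal (h : NormalFlow I γ F) (ht : t ∈ I) (hx : x ∈ paramInterval) :
    HasDerivWithinAt (fun r => normal (γ r) x) (-(ds γ F t x • tangent (γ t) x)) I t := by
  refine (rotL.hasFDerivAt.comp_hasDerivWithinAt t
    (h.smooth_tangent.hasDerivWithinAt_dt h.time ht hx)).congr_deriv ?_
  rw [h.dt_tangent ht hx, rotL_apply, rot_smul, normal, rot_rot]
  module

/-- Differentiate k = ⟨τ_s, ν⟩. The commutator contributes F k², and ν_t is tangential, hence
orthogonal to τ_s. -/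
lemma dt_curvature (h : NormalFlow I γ F) (ht : t ∈ I) (hx : x ∈ paramInterval) :
    dt I (curv γ 0) t x = ds γ (ds γ F) t x + F t x * curv γ 0 t x ^ 2 := by
  have h1 := (h.smooth_ds h.smooth_tangent).hasDerivWithinAt_dt h.time ht hx
  rw [h.dt_ds h.smooth_tangent ht hx] at h1
  have h2 : ds γ (dt I (fun t x => tangent (γ t) x)) t x
      = ds γ (fun t x => ds γ F t x • normal (γ t) x) t x := by
    simp only [ds, arcDeriv]
    rw [derivWithin_congr (fun y hy => h.dt_tangent ht hy) (h.dt_tangent ht hx)]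
    rfl
  rw [h2, h.ds_smul_normal (h.smooth_ds h.smooth_force) ht hx, h.ds_tangent ht hx] at h1
  have h3 := (h1.inner ℝ (h.dt_normal ht hx)).derivWithin (h.time.uniqueDiffOn t ht)
  refine h3.trans ?_
  simp only [h.ds_tangent ht hx, inner_neg_right, real_inner_smul_left, real_inner_smul_right,
    inner_add_left, inner_sub_left, h.inner_normal_self ht hx, SmoothFamily.inner_tangent_normal,
    real_inner_comm (tangent (γ t) x) (normal (γ t) x)]
  ring

end NormalFlow

end family

/-! ### Cubic reaction terms -/

/-- The sum of the products `k a * k b * k c` over a list of triples `(a, b, c)`. -/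
def cubicEval (l : List (ℕ × ℕ × ℕ)) (k : ℕ → ℝ) : ℝ :=
  (l.map fun p => k p.1 * k p.2.1 * k p.2.2).sum

/-- The list of triples that represents the arclength derivative of `cubicEval l`. -/
def cubicDeriv (l : List (ℕ × ℕ × ℕ)) : List (ℕ × ℕ × ℕ) :=
  l.flatMap fun p => [(p.1 + 1, p.2.1, p.2.2), (p.1, p.2.1 + 1, p.2.2), (p.1, p.2.1, p.2.2 + 1)]

/-- The cubic terms in the evolution equation of the `ℓ`-th arclength derivative of the
curvature. -/
def reaction (m : ℕ) : ℕ → List (ℕ × ℕ × ℕ)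
  | 0 => [(0, 0, 2 * m + 2)]
  | ℓ + 1 => (0, ℓ + 1, 2 * m + 2) :: cubicDeriv (reaction m ℓ)

@[simp] lemma cubicEval_nil (k : ℕ → ℝ) : cubicEval [] k = 0 := rfl

lemma cubicEval_cons (p : ℕ × ℕ × ℕ) (l : List (ℕ × ℕ × ℕ)) (k : ℕ → ℝ) :
    cubicEval (p :: l) k = k p.1 * k p.2.1 * k p.2.2 + cubicEval l k := by
  simp [cubicEval]

lemma cubicDeriv_cons (p : ℕ × ℕ × ℕ) (l : List (ℕ × ℕ × ℕ)) :
    cubicDeriv (p :: l) = (p.1 + 1, p.2.1, p.2.2) :: (p.1, p.2.1 + 1, p.2.2)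
      :: (p.1, p.2.1, p.2.2 + 1) :: cubicDeriv l := by
  simp [cubicDeriv]

/-- Fixes the total order of the quartic integrals, and the parity used at the boundary. -/
lemma reaction_order (m ℓ : ℕ) : ∀ p ∈ reaction m ℓ, p.1 + p.2.1 + p.2.2 = 2 * m + 2 + ℓ := by
  induction ℓ with
  | zero => simp [reaction]
  | succ ℓ ih =>
    intro p hp
    simp only [reaction, List.mem_cons, cubicDeriv, List.mem_flatMap, List.not_mem_nil,
      or_false] at hp
    rcases hp with rfl | ⟨q, hq, rfl | rfl | rfl⟩
    · simp; ring
    all_goals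
      have := ih q hq
      simp only
      omega

lemma ArcTower.hasDerivWithinAt_cubicEval {v : ℝ → ℝ} {k : ℕ → ℝ → ℝ} (h : ArcTower v k)
    (l : List (ℕ × ℕ × ℕ)) {x : ℝ} (hx : x ∈ paramInterval) :
    HasDerivWithinAt (fun y => cubicEval l fun i => k i y)
      (v x * cubicEval (cubicDeriv l) fun i => k i x) paramInterval x := by
  induction l with
  | nil =>
    refine (hasDerivWithinAt_const x paramInterval (0 : ℝ)).congr_deriv ?_
    simp [cubicDeriv]
  | cons p l ih =>
    simp only [cubicEval_cons, cubicDeriv_cons]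
    refine ((((h.deriv p.1 x hx).mul (h.deriv p.2.1 x hx)).mul (h.deriv p.2.2 x hx)).add
      ih).congr_deriv ?_
    simp only [Pi.mul_apply]
    ring

lemma ArcTower.continuousOn_cubicEval {v : ℝ → ℝ} {k : ℕ → ℝ → ℝ} (h : ArcTower v k)
    (l : List (ℕ × ℕ × ℕ)) : ContinuousOn (fun y => cubicEval l fun i => k i y) paramInterval :=
  fun _ hx => (h.hasDerivWithinAt_cubicEval l hx).continuousWithinAt

lemma ArcTower.abs_wint_cubicEval_le {v : ℝ → ℝ} {k : ℕ → ℝ → ℝ} (h : ArcTower v k)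
    (ho : OddVanish k) (hm : wint v (k 0) = 0) {M ℓ : ℕ} {S : ℝ} (hS : QuarticBound v k M S)
    (l : List (ℕ × ℕ × ℕ)) (hl : ∀ p ∈ l, p.1 + p.2.1 + p.2.2 + ℓ = 2 * M) :
    |wint v (fun x => (cubicEval l fun i => k i x) * k ℓ x)| ≤ l.length * (3 ^ (2 * M) * S) := by
  induction l with
  | nil => simp [wint]
  | cons p l ih =>
    have c0 := h.continuousOn_cubicEval l
    have c1 := h.continuousOn p.1
    have c2 := h.continuousOn p.2.1
    have c3 := h.continuousOn p.2.2
    have c4 := h.continuousOn ℓ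
    have e : wint v (fun x => (cubicEval (p :: l) fun i => k i x) * k ℓ x)
        = quad v k p.1 p.2.1 p.2.2 ℓ + wint v (fun x => (cubicEval l fun i => k i x) * k ℓ x) := by
      rw [quad, ← wint_add h.cont (by fun_prop) (by fun_prop)]
      exact wint_congr fun x _ => by rw [cubicEval_cons]; ring
    rw [e]
    have i1 := h.abs_quad_le ho hm hS (hl p (by simp))
    have i2 := ih fun q hq => hl q (by simp [hq])
    calc _ ≤ _ := abs_add_le _ _
      _ ≤ 3 ^ (2 * M) * S + l.length * (3 ^ (2 * M) * S) := add_le_add i1 i2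
      _ = _ := by push_cast [List.length_cons]; ring

/-! ### The polyharmonic flow -/

/-- The normal velocity of the flow. -/
def force (m : ℕ) (γ : ℝ → ℝ → Plane) (t x : ℝ) : ℝ := (-1) ^ (m + 1) * curv γ (2 * m + 2) t x

/-- The squared `L²` norm of the `ℓ`-th derivative of the curvature at time `t`. -/
def curvEnergy (γ : ℝ → ℝ → Plane) (ℓ : ℕ) (t : ℝ) : ℝ :=
  energy (speed (γ t)) (fun i => curv γ i t) ℓ

/-- The length at time `t`. -/
def curvLength (γ : ℝ → ℝ → Plane) (t : ℝ) : ℝ := wint (speed (γ t)) (fun _ => 1)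

lemma neg_one_pow_mul_self (m : ℕ) : (-1 : ℝ) ^ m * (-1) ^ m = 1 := by
  rw [← mul_pow]; simp

section integrals

variable {I : Set ℝ} {γ : ℝ → ℝ → Plane} {t x : ℝ}

lemma SmoothST.mul {I : Set ℝ} {f g : ℝ → ℝ → ℝ} (hf : SmoothST I f) (hg : SmoothST I g) :
    SmoothST I (fun t x => f t x * g t x) := ContDiffOn.mul hf hg

lemma SmoothFamily.continuousOn_wint (h : SmoothFamily I γ) {g : ℝ → ℝ → ℝ}
    (hg : SmoothST I g) : ContinuousOn (fun t => wint (speed (γ t)) (g t)) I :=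
  continuousOn_integral_param (hg.mul h.smooth_speed).continuousOn

lemma SmoothFamily.continuousOn_curvEnergy (h : SmoothFamily I γ) (ℓ : ℕ) :
    ContinuousOn (curvEnergy γ ℓ) I :=
  h.continuousOn_wint (ContDiffOn.pow (h.smooth_curv ℓ) 2)

lemma SmoothFamily.continuousOn_curvLength (h : SmoothFamily I γ) :
    ContinuousOn (curvLength γ) I :=
  h.continuousOn_wint (g := fun _ _ => 1) contDiffOn_const

lemma NormalFlow.hasDerivAt_wint {F : ℝ → ℝ → ℝ} (h : NormalFlow I γ F) {g : ℝ → ℝ → ℝ}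
    (hg : SmoothST I g) (ht : t ∈ interior I) :
    HasDerivAt (fun t => wint (speed (γ t)) (g t))
      (wint (speed (γ t)) (fun x => dt I g t x - g t x * (F t x * curv γ 0 t x))) t := by
  refine ((hg.mul h.smooth_speed).hasDerivAt_integral h.time ht).congr_deriv ?_
  refine intervalIntegral.integral_congr fun x hx => ?_
  rw [uIcc_param] at hx
  have htI := interior_subset ht
  have := ((hg.hasDerivWithinAt_dt h.time htI hx).mul
    (h.smooth_speed.hasDerivWithinAt_dt h.time htI hx)).derivWithin (h.time.uniqueDiffOn t htI)
  refine Eq.trans this ?_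
  rw [h.dt_speed htI hx]
  ring

end integrals

namespace NormalFlow

variable {m : ℕ} {I : Set ℝ} {γ : ℝ → ℝ → Plane} {t x : ℝ}

lemma ds_force (γ : ℝ → ℝ → Plane) (h : NormalFlow I γ (force m γ)) (ht : t ∈ I)
    (hx : x ∈ paramInterval) :
    ds γ (force m γ) t x = (-1) ^ (m + 1) * curv γ (2 * m + 3) t x := by
  refine h.ds_eq ht hx ((((h.arcTower ht).deriv (2 * m + 2) x hx).const_mul
    ((-1 : ℝ) ^ (m + 1))).congr_deriv ?_)
  rw [smul_eq_mul]; ring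

lemma ds_ds_force (h : NormalFlow I γ (force m γ)) (ht : t ∈ I) (hx : x ∈ paramInterval) :
    ds γ (ds γ (force m γ)) t x = (-1) ^ (m + 1) * curv γ (2 * m + 4) t x := by
  refine h.ds_eq ht hx (((((h.arcTower ht).deriv (2 * m + 3) x hx).const_mul
    ((-1 : ℝ) ^ (m + 1))).congr_of_mem (fun y hy => (ds_force γ h ht hy)) hx).congr_deriv ?_)
  rw [smul_eq_mul]; ring

/-- Induction on ℓ by the commutator formula, which adds the cubic term k k_{s^{ℓ+1}} k_{s^{2m+2}}
at each step. -/
lemma dt_curv (h : NormalFlow I γ (force m γ)) (ℓ : ℕ) :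
    ∀ t ∈ I, ∀ x ∈ paramInterval, dt I (curv γ ℓ) t x = (-1) ^ (m + 1) *
      (curv γ (ℓ + 2 * m + 4) t x + cubicEval (reaction m ℓ) fun i => curv γ i t x) := by
  induction ℓ with
  | zero =>
    intro t ht x hx
    rw [h.dt_curvature ht hx, h.ds_ds_force ht hx, force]
    simp [reaction, cubicEval]
    ring
  | succ ℓ ih =>
    intro t ht x hx
    have h1 := h.dt_ds (h.smooth_curv ℓ) ht hx
    rw [← curv_succ] at h1
    have hT := h.arcTower ht
    have h2 : ds γ (dt I (curv γ ℓ)) t x = (-1) ^ (m + 1) * (curv γ (ℓ + 2 * m + 5) t x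
        + cubicEval (cubicDeriv (reaction m ℓ)) fun i => curv γ i t x) := by
      refine h.ds_eq ht hx (((((hT.deriv (ℓ + 2 * m + 4) x hx).add
        (hT.hasDerivWithinAt_cubicEval (reaction m ℓ) hx)).const_mul
        ((-1 : ℝ) ^ (m + 1))).congr_of_mem (fun y hy => ih t ht y hy) hx).congr_deriv ?_)
      rw [smul_eq_mul]; ring
    rw [h1, h2, reaction, cubicEval_cons, force, smul_eq_mul,
      show ℓ + 1 + 2 * m + 4 = ℓ + 2 * m + 5 by ring]
    ring

/-- All odd derivatives of the curvature vanish at an end point: differentiate the boundary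
conditions in time. -/
lemma curv_odd_eq_zero (h : NormalFlow I γ (force m γ)) {e : Plane} (he : ‖e‖ = 1)
    (hx : x ∈ paramInterval) (horth : ∀ t ∈ I, inner ℝ (velocity (γ t) x) (rot e) = (0 : ℝ))
    (hodd : ∀ t ∈ I, ∀ j ≤ m, curv γ (2 * j + 1) t x = 0) (i : ℕ) :
    ∀ t ∈ I, curv γ (2 * i + 1) t x = 0 := by
  have hσ : (-1 : ℝ) ^ (m + 1) ≠ 0 := pow_ne_zero _ (by norm_num)
  induction i using Nat.strong_induction_on with
  | _ i ih =>
    intro t ht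
    rcases lt_trichotomy i (m + 1) with hi | hi | hi
    · exact hodd t ht i (by omega)
    · subst hi
      -- Order 2m + 3 comes from the orthogonality condition: ⟨τ_t, rot e⟩ = F_s ⟨ν, rot e⟩ vanishes
      -- while ⟨ν, rot e⟩ does not.
      have hτ : ∀ r ∈ I, inner ℝ (tangent (γ r) x) (rot e) = (0 : ℝ) := by
        intro r hr
        have := horth r hr
        rw [h.velocity_eq hr hx, real_inner_smul_left] at this
        exact (mul_eq_zero.1 this).resolve_left (h.speed_pos hr hx).ne'
      have h1 := (((h.smooth_tangent.hasDerivWithinAt_dt h.time ht hx).inner ℝ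
        (hasDerivWithinAt_const t I (rot e))).congr_of_mem (fun r hr => (hτ r hr).symm) ht)
      have h2 := (h.time.uniqueDiffOn t ht).eq_deriv _ h1 (hasDerivWithinAt_const _ _ (0 : ℝ))
      rw [inner_zero_right, zero_add, h.dt_tangent ht hx, real_inner_smul_left,
        ds_force γ h ht hx] at h2
      have h3 : (inner ℝ (normal (γ t) x) (rot e) : ℝ) ≠ 0 :=
        inner_rot_ne_zero (h.inner_tangent_self ht hx) he (hτ t ht)
      have h4 := (mul_eq_zero.1 h2).resolve_right h3
      exact (mul_eq_zero.1 h4).resolve_left hσ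
    -- Differentiating k_{s^{2j+1}} = 0 in time yields order 2j + 2m + 5. The cubic terms have odd
    -- total order, so each contains an odd factor already known to vanish.
    · obtain ⟨j, rfl⟩ := Nat.exists_eq_add_of_le hi
      have hj := ih j (by omega)
      have h1 := h.dt_curv (2 * j + 1) t ht x hx
      rw [dt_congr (g := fun _ _ => (0 : ℝ)) hj ht] at h1
      have h2 : cubicEval (reaction m (2 * j + 1)) (fun i => curv γ i t x) = 0 := by
        refine List.sum_eq_zero ?_
        simp only [List.mem_map]
        rintro _ ⟨p, hp, rfl⟩
        have hs := reaction_order m _ p hp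
        have hz : ∀ a, Odd a → a ≤ 2 * m + 2 + (2 * j + 1) → curv γ a t x = 0 := by
          rintro a ⟨b, rfl⟩ hb
          exact ih b (by omega) t ht
        have : Odd p.1 ∨ Odd p.2.1 ∨ Odd p.2.2 := by
          simp only [Nat.odd_iff]
          omega
        rcases this with h' | h' | h' <;> rw [hz _ h' (by omega)] <;> ring
      rw [h2, add_zero] at h1
      have h3 : dt I (fun _ _ => (0 : ℝ)) t x = 0 := by simp [dt]
      rw [h3] at h1
      have h4 := (mul_eq_zero.1 h1.symm).resolve_left hσ
      rwa [show 2 * j + 1 + 2 * m + 4 = 2 * (m + 1 + 1 + j) + 1 by ring] at h4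

end NormalFlow

/-- A solution of the polyharmonic flow for which all odd derivatives of the curvature vanish at
the end points. -/
structure NeumannFlow (m : ℕ) (I : Set ℝ) (γ : ℝ → ℝ → Plane) : Prop
    extends NormalFlow I γ (force m γ) where
  odd : ∀ t ∈ I, OddVanish (fun ℓ => curv γ ℓ t)

namespace NeumannFlow

variable {m : ℕ} {I : Set ℝ} {γ : ℝ → ℝ → Plane} {t : ℝ}

lemma hasDerivAt_length (h : NeumannFlow m I γ) (ht : t ∈ interior I) :
    HasDerivAt (curvLength γ) (-curvEnergy γ (m + 1) t) t := by
  have htI := interior_subset ht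
  refine (h.hasDerivAt_wint (g := fun _ _ => 1) contDiffOn_const ht).congr_deriv ?_
  have h1 := (h.arcTower htI).wint_mul_add_two_mul (h.odd t htI) (m + 1) 0
  rw [zero_add, zero_add] at h1
  have h2 : wint (speed (γ t)) (fun x => dt I (fun _ _ => (1 : ℝ)) t x
      - 1 * (force m γ t x * curv γ 0 t x))
      = wint (speed (γ t)) (fun x => (-(-1) ^ (m + 1)) *
        (curv γ 0 t x * curv γ (2 * (m + 1)) t x)) := by
    refine wint_congr fun x _ => ?_
    rw [show dt I (fun _ _ => (1 : ℝ)) t x = 0 by simp [dt], force,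
      show 2 * (m + 1) = 2 * m + 2 by ring]
    ring
  rw [h2, wint_const_mul, h1, curvEnergy, neg_mul, ← mul_assoc, neg_one_pow_mul_self, one_mul]

/-- The reaction term F k² cancels the change of ds, and ∫ F_ss ds is a boundary term in
k_{s^{2m+3}}. -/
lemma hasDerivAt_wint_curvature (h : NeumannFlow m I γ) (ht : t ∈ interior I) :
    HasDerivAt (fun t => wint (speed (γ t)) (curv γ 0 t)) 0 t := by
  have htI := interior_subset ht
  refine (h.hasDerivAt_wint (h.smooth_curv 0) ht).congr_deriv ?_
  have h2 : wint (speed (γ t)) (fun x => dt I (curv γ 0) t x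
      - curv γ 0 t x * (force m γ t x * curv γ 0 t x))
      = wint (speed (γ t)) (fun x => (-1) ^ (m + 1) * curv γ (2 * m + 3 + 1) t x) := by
    refine wint_congr fun x hx => ?_
    rw [h.dt_curvature htI hx, h.ds_ds_force htI hx]
    ring
  have h3 : curv γ (2 * m + 3) t (-1) = 0 ∧ curv γ (2 * m + 3) t 1 = 0 :=
    h.odd t htI (2 * m + 3) ⟨m + 1, by ring⟩
  rw [h2, wint_const_mul, (h.arcTower htI).wint_succ (2 * m + 3), h3.1, h3.2]
  simp

lemma wint_curvature_eq_zero (h : NeumannFlow m I γ) {t₀ : ℝ} (ht₀ : t₀ ∈ I)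
    (h0 : wint (speed (γ t₀)) (curv γ 0 t₀) = 0) (ht : t ∈ I) :
    wint (speed (γ t)) (curv γ 0 t) = 0 := by
  have hc := h.continuousOn_wint (h.smooth_curv 0)
  have hd : ∀ r ∈ interior I, HasDerivAt (fun t => wint (speed (γ t)) (curv γ 0 t)) 0 r :=
    fun r hr => h.hasDerivAt_wint_curvature hr
  have hdiff : DifferentiableOn ℝ (fun t => wint (speed (γ t)) (curv γ 0 t)) (interior I) :=
    fun r hr => (hd r hr).differentiableAt.differentiableWithinAt
  have ha := antitoneOn_of_deriv_nonpos h.time.1 hc hdiff fun r hr => (hd r hr).deriv.le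
  have hmo := monotoneOn_of_deriv_nonneg h.time.1 hc hdiff fun r hr => (hd r hr).deriv.ge
  rw [← h0]
  rcases le_total t t₀ with hle | hle
  · exact le_antisymm (hmo ht ht₀ hle) (ha ht ht₀ hle)
  · exact le_antisymm (ha ht₀ ht hle) (hmo ht₀ ht hle)

end NeumannFlow

/-- The combinatorial factor in the evolution inequality of the curvature energies. -/
def quarticConst (m ℓ : ℕ) : ℝ := (2 * (reaction m ℓ).length + 1) * 3 ^ (2 * (ℓ + m + 1))

lemma quarticConst_pos (m ℓ : ℕ) : 0 < quarticConst m ℓ := by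
  unfold quarticConst; positivity

namespace NeumannFlow

variable {m : ℕ} {I : Set ℝ} {γ : ℝ → ℝ → Plane} {t : ℝ}

/-- The evolution inequality of the curvature energies. -/
lemma exists_hasDerivAt_curvEnergy (h : NeumannFlow m I γ) (ht : t ∈ interior I)
    (hm : wint (speed (γ t)) (curv γ 0 t) = 0) (ℓ : ℕ) :
    ∃ D, HasDerivAt (curvEnergy γ ℓ) D t ∧
      ∀ S, ArcTower.QuarticBound (speed (γ t)) (fun i => curv γ i t) (ℓ + m + 1) S →
        D ≤ -2 * curvEnergy γ (ℓ + m + 2) t + quarticConst m ℓ * S := by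
  have htI := interior_subset ht
  have hT := h.arcTower htI
  have ho := h.odd t htI
  refine ⟨_, h.hasDerivAt_wint (g := fun t x => curv γ ℓ t x ^ 2)
    (ContDiffOn.pow (h.smooth_curv ℓ) 2) ht, fun S hS => ?_⟩
  set v := speed (γ t)
  set k : ℕ → ℝ → ℝ := fun i => curv γ i t
  set σ : ℝ := (-1) ^ (m + 1)
  have cℓ := hT.continuousOn ℓ
  have c0 := hT.continuousOn 0
  have cm := hT.continuousOn (2 * m + 2)
  have cN := hT.continuousOn (ℓ + 2 * (m + 2))
  have cc := hT.continuousOn_cubicEval (reaction m ℓ)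
  have h2 : wint v (fun x => dt I (fun t x => curv γ ℓ t x ^ 2) t x
      - curv γ ℓ t x ^ 2 * (force m γ t x * curv γ 0 t x))
      = wint v (fun x => ((2 * σ) * (k ℓ x * k (ℓ + 2 * (m + 2)) x)
        + (2 * σ) * ((cubicEval (reaction m ℓ) fun i => k i x) * k ℓ x))
        + (-σ) * (k ℓ x * k ℓ x * k 0 x * k (2 * m + 2) x)) := by
    refine wint_congr fun x hx => ?_
    have h3 := (((h.smooth_curv ℓ).hasDerivWithinAt_dt h.time htI hx).pow 2).derivWithin
      (h.time.uniqueDiffOn t htI)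
    have h4 : dt I (fun t x => curv γ ℓ t x ^ 2) t x
        = 2 * curv γ ℓ t x * dt I (curv γ ℓ) t x := by
      refine Eq.trans h3 ?_
      norm_num
    rw [h4, h.dt_curv ℓ t htI x hx, force, show ℓ + 2 * m + 4 = ℓ + 2 * (m + 2) by ring]
    simp only [k, σ]
    ring
  rw [h2, wint_add hT.cont (by fun_prop) (by fun_prop), wint_add hT.cont (by fun_prop) (by fun_prop),
    wint_const_mul, wint_const_mul, wint_const_mul, hT.wint_mul_add_two_mul ho (m + 2) ℓ]
  have i1 := hT.abs_wint_cubicEval_le ho hm hS (ℓ := ℓ) (reaction m ℓ) fun p hp => by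
    rw [reaction_order m ℓ p hp]; ring
  have i2 := hT.abs_quad_le ho hm hS (a := ℓ) (b := ℓ) (c := 0) (d := 2 * m + 2) (by ring)
  have hσ : |σ| = 1 := by simp [σ]
  have hσ2 : σ * (-1) ^ (m + 2) = -1 := by
    rw [pow_succ (-1 : ℝ) (m + 1), ← mul_assoc, neg_one_pow_mul_self, one_mul]
  have e1 : (2 * σ) * wint v (fun x => (cubicEval (reaction m ℓ) fun i => k i x) * k ℓ x)
      ≤ 2 * ((reaction m ℓ).length * (3 ^ (2 * (ℓ + m + 1)) * S)) := by
    refine (le_abs_self _).trans ?_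
    rw [abs_mul, abs_mul, hσ, abs_two, mul_one]
    gcongr
  have e2 : (-σ) * wint v (fun x => k ℓ x * k ℓ x * k 0 x * k (2 * m + 2) x)
      ≤ 3 ^ (2 * (ℓ + m + 1)) * S := by
    refine (le_abs_self _).trans ?_
    rw [abs_mul, abs_neg, hσ, one_mul]
    exact i2
  have e3 : (2 * σ) * ((-1) ^ (m + 2) * energy v k (ℓ + (m + 2)))
      = -2 * curvEnergy γ (ℓ + m + 2) t := by
    rw [← mul_assoc, mul_assoc 2 σ, hσ2, curvEnergy, ← add_assoc]
    ring
  rw [e3]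
  unfold quarticConst
  linarith

end NeumannFlow

/-! ### A differential inequality -/

lemma Ioo_subset_interior_of_convex {I : Set ℝ} (hI : Convex ℝ I) {a b : ℝ} (ha : a ∈ I)
    (hb : b ∈ I) : Ioo a b ⊆ interior I := by
  rw [← interior_Icc]
  exact interior_mono (hI.ordConnected.out ha hb)

/-- Exponential decay from the differential inequality `f' ≤ -lam f + C e^{-2 lam (t - a)}`. -/
lemma le_mul_exp_of_deriv_le {f : ℝ → ℝ} {a b lam C : ℝ} (hab : a ≤ b) (hlam : 0 < lam)
    (hC : 0 ≤ C) (hf : ContinuousOn f (Icc a b))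
    (hd : ∀ t ∈ Ioo a b, ∃ D, HasDerivAt f D t ∧
      D ≤ -lam * f t + C * Real.exp (-(2 * lam * (t - a)))) :
    f b ≤ (f a + C / lam) * Real.exp (-(lam * (b - a))) := by
  -- The last term of g compensates the forcing exactly, so g is nonincreasing.
  set g : ℝ → ℝ := fun t => f t * Real.exp (lam * (t - a))
    + C / lam * Real.exp (-(lam * (t - a))) with hg
  have hgc : ContinuousOn g (Icc a b) := by
    simp only [hg]; fun_prop
  have hgd : ∀ t ∈ Ioo a b, ∃ D, HasDerivAt g D t ∧ D ≤ 0 := by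
    intro t ht
    obtain ⟨D, hD, hle⟩ := hd t ht
    have h0 : HasDerivAt (fun t => lam * (t - a)) lam t := by
      simpa using ((hasDerivAt_id t).sub_const a).const_mul lam
    refine ⟨_, (hD.mul h0.exp).add ((h0.neg.exp).const_mul (C / lam)), ?_⟩
    have e1 : Real.exp (-(2 * lam * (t - a))) * Real.exp (lam * (t - a))
        = Real.exp (-(lam * (t - a))) := by
      rw [← Real.exp_add]; congr 1; ring
    have e2 : C / lam * (Real.exp (-(lam * (t - a))) * -lam)
        = -(C * Real.exp (-(lam * (t - a)))) := by
      field_simp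
    have e3 := mul_le_mul_of_nonneg_right hle (Real.exp_pos (lam * (t - a))).le
    change D * Real.exp (lam * (t - a)) + f t * (Real.exp (lam * (t - a)) * lam)
      + C / lam * (Real.exp (-(lam * (t - a))) * -lam) ≤ 0
    rw [e2, ← e1]
    linarith
  have hanti : AntitoneOn g (Icc a b) := by
    refine antitoneOn_of_deriv_nonpos (convex_Icc a b) hgc ?_ ?_
    · rw [interior_Icc]
      intro t ht
      obtain ⟨D, hD, -⟩ := hgd t ht
      exact hD.differentiableAt.differentiableWithinAt
    · rw [interior_Icc]
      intro t ht
      obtain ⟨D, hD, hle⟩ := hgd t ht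
      rwa [hD.deriv]
  have h1 := hanti (left_mem_Icc.2 hab) (right_mem_Icc.2 hab) hab
  have h2 : f b * Real.exp (lam * (b - a)) ≤ f a + C / lam := by
    have h3 : 0 ≤ C / lam * Real.exp (-(lam * (b - a))) := by positivity
    simp only [hg, sub_self, mul_zero, neg_zero, Real.exp_zero, mul_one] at h1
    linarith
  rw [Real.exp_neg, ← div_eq_mul_inv, le_div_iff₀ (Real.exp_pos _)]
  exact h2

/-! ### Decay of the curvature energies -/

/-- The threshold for the scale invariant energy. -/
def smallness (m : ℕ) : ℝ := (4 * quarticConst m 0)⁻¹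

lemma smallness_pos (m : ℕ) : 0 < smallness m :=
  inv_pos.2 (mul_pos (by norm_num) (quarticConst_pos m 0))

/-- The rate of decay for curves of length at most `L₀`. -/
def decayRate (m : ℕ) (L₀ : ℝ) : ℝ := (L₀ ^ (2 * (m + 2)))⁻¹

lemma decayRate_pos (m : ℕ) {L₀ : ℝ} (h : 0 < L₀) : 0 < decayRate m L₀ :=
  inv_pos.2 (pow_pos h _)

/-- The factor of the reaction terms in the evolution inequality after absorption. -/
def reactionConst (m ℓ : ℕ) : ℝ :=
  quarticConst m ℓ * (4 ^ (ℓ + m + 2) * quarticConst m ℓ ^ (2 * (ℓ + m + 1) + 1))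

lemma reactionConst_pos (m ℓ : ℕ) : 0 < reactionConst m ℓ := by
  have := quarticConst_pos m ℓ
  unfold reactionConst; positivity

/-- The factor in the decay estimate of the `ℓ`-th curvature energy, from the initial length `L₀`
and the initial energies `a₀` and `aℓ`. -/
def decayConst (m ℓ : ℕ) (L₀ a₀ aℓ : ℝ) : ℝ :=
  aℓ + reactionConst m ℓ * a₀ ^ (2 * (ℓ + m + 1) + 3) / decayRate m L₀

namespace NeumannFlow

variable {m : ℕ} {I : Set ℝ} {γ : ℝ → ℝ → Plane} {t t₀ L₀ : ℝ}

lemma curvEnergy_nonneg (h : NeumannFlow m I γ) (ht : t ∈ I) (ℓ : ℕ) : 0 ≤ curvEnergy γ ℓ t :=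
  (h.arcTower ht).energy_nonneg ℓ

lemma curvLength_pos (h : NeumannFlow m I γ) (ht : t ∈ I) : 0 < curvLength γ t :=
  (h.arcTower ht).wint_one_pos

lemma antitoneOn_curvLength (h : NeumannFlow m I γ) : AntitoneOn (curvLength γ) I := by
  refine antitoneOn_of_deriv_nonpos h.time.1 h.continuousOn_curvLength
    (fun r hr => (h.hasDerivAt_length hr).differentiableAt.differentiableWithinAt) fun r hr => ?_
  rw [(h.hasDerivAt_length hr).deriv, neg_nonpos]
  exact h.curvEnergy_nonneg (interior_subset hr) _

/-- The Poincaré inequality in terms of a bound for the length. -/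
lemma decayRate_mul_curvEnergy_le (h : NeumannFlow m I γ) (ht : t ∈ I)
    (hm : wint (speed (γ t)) (curv γ 0 t) = 0) (hL : curvLength γ t ≤ L₀) (ℓ : ℕ) :
    decayRate m L₀ * curvEnergy γ ℓ t ≤ curvEnergy γ (ℓ + m + 2) t := by
  have h1 := (h.arcTower ht).energy_le_length_pow_mul (h.odd t ht) hm ℓ (m + 2)
  have hp := h.curvLength_pos ht
  have hL0 : 0 < L₀ := hp.trans_le hL
  have hA := h.curvEnergy_nonneg ht (ℓ + m + 2)
  rw [decayRate, inv_mul_le_iff₀ (pow_pos hL0 _)]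
  refine h1.trans ?_
  change curvLength γ t ^ (2 * (m + 2)) * curvEnergy γ (ℓ + m + 2) t ≤ _
  gcongr

/-- A small scale invariant energy stays small. -/
lemma length_mul_curvEnergy_le (h : NeumannFlow m I γ)
    (hm : ∀ t ∈ I, wint (speed (γ t)) (curv γ 0 t) = 0) (ht₀ : t₀ ∈ I)
    (hs : curvLength γ t₀ * curvEnergy γ 0 t₀ ≤ smallness m) (ht : t ∈ I) (htt : t₀ ≤ t) :
    curvLength γ t * curvEnergy γ 0 t ≤ 2 * smallness m := by
  have hsp := smallness_pos m
  have hqp := quarticConst_pos m 0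
  rcases htt.eq_or_lt with rfl | hlt
  · linarith
  have hIcc : Icc t₀ t ⊆ I := h.time.1.ordConnected.out ht₀ ht
  have hIoo := Ioo_subset_interior_of_convex h.time.1 ht₀ ht
  have hc : ContinuousOn (fun r => curvLength γ r * curvEnergy γ 0 r) I :=
    h.continuousOn_curvLength.mul (h.continuousOn_curvEnergy 0)
  -- Two-sided derivatives are available only at interior times, so the comparison starts slightly
  -- after t₀, where the strict bound persists by continuity.
  obtain ⟨a, haE, ha⟩ : ∃ a, curvLength γ a * curvEnergy γ 0 a < 2 * smallness m ∧
      a ∈ Ioo t₀ t := by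
    have h1 : Filter.Tendsto (fun r => curvLength γ r * curvEnergy γ 0 r)
        (nhdsWithin t₀ (Ioi t₀)) (nhds (curvLength γ t₀ * curvEnergy γ 0 t₀)) :=
      ((hc.mono hIcc) t₀ (left_mem_Icc.2 htt)).mono_left
        (nhdsWithin_le_of_mem (Icc_mem_nhdsGT_of_mem (left_mem_Ico.2 hlt)))
    exact ((h1.eventually (gt_mem_nhds (by linarith))).and
      (Ioo_mem_nhdsGT hlt)).exists
  have key : ∀ r ∈ interior I, ∃ D, HasDerivAt (fun r => curvLength γ r * curvEnergy γ 0 r) D r ∧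
      (curvLength γ r * curvEnergy γ 0 r = 2 * smallness m → D < 0) := by
    intro r hr
    have hrI := interior_subset hr
    obtain ⟨D, hD, hle⟩ := h.exists_hasDerivAt_curvEnergy hr (hm r hrI) 0
    refine ⟨_, (h.hasDerivAt_length hr).mul hD, fun hE => ?_⟩
    have hT := h.arcTower hrI
    obtain ⟨S, hS⟩ := hT.exists_quarticBound (0 + m + 1)
    have hSle := hT.quarticBound_le_length (h.odd r hrI) (hm r hrI) hS
    change S ≤ 2 * (curvLength γ r * curvEnergy γ 0 r) * curvEnergy γ (0 + m + 1 + 1) r at hSle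
    have hDle := hle S hS
    have hL := h.curvLength_pos hrI
    have hA0 := h.curvEnergy_nonneg hrI 0
    have hA0p : 0 < curvEnergy γ 0 r := by
      refine hA0.lt_of_ne fun hz => ?_
      rw [← hz, mul_zero] at hE
      linarith
    have hAn : 0 < curvEnergy γ (0 + m + 2) r :=
      lt_of_lt_of_le (mul_pos (decayRate_pos m hL) hA0p)
        (h.decayRate_mul_curvEnergy_le hrI (hm r hrI) le_rfl 0)
    have hAm := h.curvEnergy_nonneg hrI (m + 1)
    rw [hE] at hSle
    -- At the barrier L E_0 = 2 `smallness m`, which is chosen so that the quartic terms absorb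
    -- exactly one of the two copies of E_{m+2}.
    have hCS : quarticConst m 0 * S ≤ curvEnergy γ (0 + m + 2) r := by
      refine (mul_le_mul_of_nonneg_left hSle hqp.le).trans (le_of_eq ?_)
      unfold smallness
      rw [show 0 + m + 1 + 1 = 0 + m + 2 by ring]
      field_simp
      ring
    have hDneg : D < 0 := by linarith
    nlinarith
  choose! D hD hDneg using key
  have haI : ∀ r ∈ Ico a t, r ∈ interior I := fun r hr => hIoo ⟨ha.1.trans_le hr.1, hr.2⟩
  -- The barrier cannot be crossed, since the derivative is strictly negative on it.
  exact image_le_of_deriv_right_lt_deriv_boundary' (f' := D) (B := fun _ => 2 * smallness m)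
    (B' := fun _ => 0) (hc.mono ((Icc_subset_Icc_left ha.1.le).trans hIcc))
    (fun r hr => (hD r (haI r hr)).hasDerivWithinAt) haE.le continuousOn_const
    (fun r _ => hasDerivWithinAt_const _ _ _) (fun r hr hE => hDneg r (haI r hr) hE)
    (right_mem_Icc.2 ha.2.le)

/-- One copy of E_{m+2} survives the absorption, and Poincaré turns it into decay; the length bound
is preserved because the length decreases. -/
lemma curvEnergy_zero_le (h : NeumannFlow m I γ)
    (hm : ∀ t ∈ I, wint (speed (γ t)) (curv γ 0 t) = 0) (ht₀ : t₀ ∈ I)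
    (hL : curvLength γ t₀ ≤ L₀)
    (hs : curvLength γ t₀ * curvEnergy γ 0 t₀ ≤ smallness m) (ht : t ∈ I) (htt : t₀ ≤ t) :
    curvEnergy γ 0 t ≤ curvEnergy γ 0 t₀ * Real.exp (-(decayRate m L₀ * (t - t₀))) := by
  have hL0 : 0 < L₀ := (h.curvLength_pos ht₀).trans_le hL
  have hqp := quarticConst_pos m 0
  have hIcc : Icc t₀ t ⊆ I := h.time.1.ordConnected.out ht₀ ht
  have := le_mul_exp_of_deriv_le (C := 0) htt (decayRate_pos m hL0) le_rfl
    ((h.continuousOn_curvEnergy 0).mono hIcc) fun r hr => by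
      have hri := Ioo_subset_interior_of_convex h.time.1 ht₀ ht hr
      have hrI := interior_subset hri
      obtain ⟨D, hD, hle⟩ := h.exists_hasDerivAt_curvEnergy hri (hm r hrI) 0
      refine ⟨D, hD, ?_⟩
      have hT := h.arcTower hrI
      obtain ⟨S, hS⟩ := hT.exists_quarticBound (0 + m + 1)
      have hSle := hT.quarticBound_le_length (h.odd r hrI) (hm r hrI) hS
      change S ≤ 2 * (curvLength γ r * curvEnergy γ 0 r) * curvEnergy γ (0 + m + 1 + 1) r at hSle
      have hE := h.length_mul_curvEnergy_le hm ht₀ hs hrI hr.1.le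
      have hAn := h.curvEnergy_nonneg hrI (0 + m + 2)
      have hP := h.decayRate_mul_curvEnergy_le hrI (hm r hrI)
        ((h.antitoneOn_curvLength ht₀ hrI hr.1.le).trans hL) 0
      have hCS : quarticConst m 0 * S ≤ curvEnergy γ (0 + m + 2) r := by
        calc quarticConst m 0 * S
            ≤ quarticConst m 0 * (2 * (2 * smallness m) * curvEnergy γ (0 + m + 2) r) := by
              refine mul_le_mul_of_nonneg_left (hSle.trans ?_) hqp.le
              exact mul_le_mul_of_nonneg_right (by linarith) hAn
          _ = curvEnergy γ (0 + m + 2) r := by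
              unfold smallness
              field_simp
              ring
      have := hle S hS
      linarith
  simpa using this

/-- The quartic terms cost one copy of the top energy and a power of E_0. That power already decays,
so it is a harmless forcing term. -/
lemma curvEnergy_le (h : NeumannFlow m I γ)
    (hm : ∀ t ∈ I, wint (speed (γ t)) (curv γ 0 t) = 0) (ht₀ : t₀ ∈ I)
    (hL : curvLength γ t₀ ≤ L₀)
    (hs : curvLength γ t₀ * curvEnergy γ 0 t₀ ≤ smallness m) (ht : t ∈ I) (htt : t₀ ≤ t) (ℓ : ℕ) :
    curvEnergy γ ℓ t ≤ decayConst m ℓ L₀ (curvEnergy γ 0 t₀) (curvEnergy γ ℓ t₀)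
      * Real.exp (-(decayRate m L₀ * (t - t₀))) := by
  have hL0 : 0 < L₀ := (h.curvLength_pos ht₀).trans_le hL
  have hlam := decayRate_pos m hL0
  have hqp := quarticConst_pos m ℓ
  have hrp := reactionConst_pos m ℓ
  have hIcc : Icc t₀ t ⊆ I := h.time.1.ordConnected.out ht₀ ht
  have hA0 := h.curvEnergy_nonneg ht₀ 0
  refine le_mul_exp_of_deriv_le htt hlam (by positivity)
    ((h.continuousOn_curvEnergy ℓ).mono hIcc) fun r hr => ?_
  have hri := Ioo_subset_interior_of_convex h.time.1 ht₀ ht hr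
  have hrI := interior_subset hri
  obtain ⟨D, hD, hle⟩ := h.exists_hasDerivAt_curvEnergy hri (hm r hrI) ℓ
  refine ⟨D, hD, ?_⟩
  have hT := h.arcTower hrI
  obtain ⟨S, hS⟩ := hT.exists_quarticBound (ℓ + m + 1)
  -- With η = 1 / `quarticConst m ℓ`, exactly one copy of the top energy is absorbed.
  have hSle := hT.quarticBound_le_add hS (inv_pos.2 hqp)
  change S ≤ (quarticConst m ℓ)⁻¹ * curvEnergy γ (ℓ + m + 2) r + 4 ^ (ℓ + m + 2)
    * (quarticConst m ℓ)⁻¹⁻¹ ^ (2 * (ℓ + m + 1) + 1)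
    * curvEnergy γ 0 r ^ (2 * (ℓ + m + 1) + 3) at hSle
  rw [inv_inv] at hSle
  have hCS : quarticConst m ℓ * S ≤ curvEnergy γ (ℓ + m + 2) r
      + reactionConst m ℓ * curvEnergy γ 0 r ^ (2 * (ℓ + m + 1) + 3) := by
    refine (mul_le_mul_of_nonneg_left hSle hqp.le).trans (le_of_eq ?_)
    rw [mul_add, mul_inv_cancel_left₀ hqp.ne']
    unfold reactionConst
    ring
  have hP := h.decayRate_mul_curvEnergy_le hrI (hm r hrI)
    ((h.antitoneOn_curvLength ht₀ hrI hr.1.le).trans hL) ℓ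
  have h0 := h.curvEnergy_zero_le hm ht₀ hL hs hrI hr.1.le
  -- The exponent is at least 2, so the forcing decays at twice the rate λ and causes no resonance.
  have h1 : curvEnergy γ 0 r ^ (2 * (ℓ + m + 1) + 3)
      ≤ curvEnergy γ 0 t₀ ^ (2 * (ℓ + m + 1) + 3)
        * Real.exp (-(2 * decayRate m L₀ * (r - t₀))) := by
    refine (pow_le_pow_left₀ (h.curvEnergy_nonneg hrI 0) h0 _).trans ?_
    rw [mul_pow, ← Real.exp_nat_mul]
    refine mul_le_mul_of_nonneg_left (Real.exp_le_exp.2 ?_) (by positivity)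
    have hpos : 0 ≤ decayRate m L₀ * (r - t₀) := mul_nonneg hlam.le (sub_nonneg.2 hr.1.le)
    have hn : (2 : ℝ) ≤ ((2 * (ℓ + m + 1) + 3 : ℕ) : ℝ) := by exact_mod_cast (by omega)
    nlinarith
  have h2 := mul_le_mul_of_nonneg_left h1 hrp.le
  have h3 := hle S hS
  linarith

/-- Decay of an energy gives decay in the supremum norm. -/
lemma abs_curv_le (h : NeumannFlow m I γ) (ht : t ∈ I)
    (hm : wint (speed (γ t)) (curv γ 0 t) = 0) (hL : curvLength γ t ≤ L₀) {ℓ : ℕ} {C lam : ℝ}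
    (hA : curvEnergy γ (ℓ + 1) t ≤ C * Real.exp (-lam * t)) {x : ℝ} (hx : x ∈ paramInterval) :
    |curv γ ℓ t x| ≤ √(L₀ * C) * Real.exp (-(lam / 2) * t) := by
  have h1 := (h.arcTower ht).sq_le_length_mul_energy (h.odd t ht) hm ℓ hx
  have hL0 : 0 < L₀ := (h.curvLength_pos ht).trans_le hL
  have h2 : curv γ ℓ t x ^ 2 ≤ L₀ * C * Real.exp (-lam * t) := by
    calc curv γ ℓ t x ^ 2 ≤ curvLength γ t * curvEnergy γ (ℓ + 1) t := h1
      _ ≤ L₀ * (C * Real.exp (-lam * t)) :=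
        mul_le_mul hL hA (h.curvEnergy_nonneg ht _) hL0.le
      _ = _ := by ring
  refine (Real.abs_le_sqrt h2).trans (le_of_eq ?_)
  rw [Real.sqrt_mul' _ (Real.exp_pos _).le, ← Real.exp_half]
  congr 2
  ring

/-- A flow that exists for all time becomes small in the scale invariant sense. -/
lemma exists_small (h : NeumannFlow m (Ici 0) γ)
    (hm : ∀ t ∈ Ici (0 : ℝ), wint (speed (γ t)) (curv γ 0 t) = 0) :
    ∃ t₀ ∈ Ici (0 : ℝ), curvLength γ t₀ * curvEnergy γ 0 t₀ ≤ smallness m := by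
  by_contra! hne
  have h00 : (0 : ℝ) ∈ Ici (0 : ℝ) := self_mem_Ici
  set L := curvLength γ 0
  have hL : 0 < L := h.curvLength_pos h00
  have hs := smallness_pos m
  -- From `smallness m` < L E_0 ≤ L^{2m+3} E_{m+1}, with L at most its initial value.
  set c := smallness m / L ^ (2 * (m + 1) + 1) with hc
  have hcpos : 0 < c := by positivity
  have hbound : ∀ r ∈ Ici (0 : ℝ), c ≤ curvEnergy γ (m + 1) r := by
    intro r hr
    have h1 := (h.arcTower hr).energy_le_length_pow_mul (h.odd r hr) (hm r hr) 0 (m + 1)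
    rw [zero_add] at h1
    change curvEnergy γ 0 r ≤ curvLength γ r ^ (2 * (m + 1)) * curvEnergy γ (m + 1) r at h1
    have hLr := h.curvLength_pos hr
    have hLL : curvLength γ r ≤ L := h.antitoneOn_curvLength h00 hr hr
    have hA := h.curvEnergy_nonneg hr (m + 1)
    rw [hc, div_le_iff₀ (by positivity)]
    calc smallness m ≤ curvLength γ r * curvEnergy γ 0 r := (hne r hr).le
      _ ≤ curvLength γ r * (curvLength γ r ^ (2 * (m + 1)) * curvEnergy γ (m + 1) r) := by gcongr
      _ ≤ L * (L ^ (2 * (m + 1)) * curvEnergy γ (m + 1) r) := by gcongr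
      _ = _ := by ring
  -- The length falls at speed at least c, so it would be at most zero at time L / c.
  have hanti := (convex_Ici (0 : ℝ)).image_sub_le_mul_sub_of_deriv_le (C := -c)
    h.continuousOn_curvLength
    (fun r hr => (h.hasDerivAt_length hr).differentiableAt.differentiableWithinAt)
    (fun r hr => by
      rw [(h.hasDerivAt_length hr).deriv, neg_le_neg_iff]
      exact hbound r (interior_subset hr)) 0 h00 (L / c) (by simp; positivity) (by positivity)
  have hpos := h.curvLength_pos (t := L / c) (by simp; positivity)
  rw [sub_zero, neg_mul, mul_div_cancel₀ _ hcpos.ne'] at hanti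
  change curvLength γ (L / c) - L ≤ -L at hanti
  linarith

/-- A flow that exists for all time has exponentially decaying energies. -/
lemma exists_decay (h : NeumannFlow m (Ici 0) γ)
    (hm : ∀ t ∈ Ici (0 : ℝ), wint (speed (γ t)) (curv γ 0 t) = 0)
    (hL : curvLength γ 0 ≤ L₀) (ℓ : ℕ) :
    ∃ C, ∀ t ∈ Ici (0 : ℝ), curvEnergy γ ℓ t ≤ C * Real.exp (-decayRate m L₀ * t) := by
  have h00 : (0 : ℝ) ∈ Ici (0 : ℝ) := self_mem_Ici
  obtain ⟨t₀, ht₀, hs⟩ := h.exists_small hm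
  have hL₀ : curvLength γ t₀ ≤ L₀ := (h.antitoneOn_curvLength h00 ht₀ ht₀).trans hL
  have hlam := decayRate_pos m ((h.curvLength_pos h00).trans_le hL)
  obtain ⟨B, hB⟩ := isCompact_Icc.exists_bound_of_continuousOn
    ((h.continuousOn_curvEnergy ℓ).mono (fun r (hr : r ∈ Icc 0 t₀) => hr.1))
  set lam := decayRate m L₀
  set K := decayConst m ℓ L₀ (curvEnergy γ 0 t₀) (curvEnergy γ ℓ t₀)
  have hexp : ∀ t, Real.exp (-(lam * (t - t₀))) = Real.exp (lam * t₀) * Real.exp (-lam * t) := by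
    intro t
    rw [← Real.exp_add]; congr 1; ring
  -- The factor e^{λt₀} shifts the origin of time; before t₀ the shifted exponential is at least 1,
  -- so the compactness bound B suffices.
  refine ⟨max B K * Real.exp (lam * t₀), fun t ht => ?_⟩
  rw [mul_assoc, ← hexp]
  rcases le_total t t₀ with hle | hle
  · have h1 : curvEnergy γ ℓ t ≤ B := (le_abs_self _).trans (hB t ⟨ht, hle⟩)
    have h2 : 0 ≤ B := (h.curvEnergy_nonneg ht ℓ).trans h1
    refine (h1.trans (le_max_left B K)).trans ?_
    refine le_mul_of_one_le_right (h2.trans (le_max_left _ _)) (Real.one_le_exp ?_)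
    nlinarith
  · exact (h.curvEnergy_le hm ht₀ hL₀ hs ht hle ℓ).trans
      (mul_le_mul_of_nonneg_right (le_max_right _ _) (Real.exp_pos _).le)

end NeumannFlow

/-! ### Solutions of the boundary value problem -/

lemma velocity_congr {c c' : ℝ → Plane} (h : ∀ x ∈ paramInterval, c x = c' x) {x : ℝ}
    (hx : x ∈ paramInterval) : velocity c x = velocity c' x :=
  derivWithin_congr h (h x hx)

lemma arcDeriv_congr {E : Type*} [NormedAddCommGroup E] [NormedSpace ℝ E] {c c' : ℝ → Plane}
    (h : ∀ x ∈ paramInterval, c x = c' x) {f g : ℝ → E} (hfg : ∀ x ∈ paramInterval, f x = g x)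
    {x : ℝ} (hx : x ∈ paramInterval) : arcDeriv c f x = arcDeriv c' g x := by
  simp only [arcDeriv, speed]
  rw [velocity_congr h hx, derivWithin_congr hfg (hfg x hx)]

/-- All derivatives are taken within [-1, 1], so agreement there suffices. This transfers data from
`γ 0` to `γ₀`. -/
lemma curvatureDeriv_congr {c c' : ℝ → Plane} (h : ∀ x ∈ paramInterval, c x = c' x) (ℓ : ℕ) :
    ∀ x ∈ paramInterval, curvatureDeriv c ℓ x = curvatureDeriv c' ℓ x := by
  have hτ : ∀ x ∈ paramInterval, tangent c x = tangent c' x := fun x hx => arcDeriv_congr h h hx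
  induction ℓ with
  | zero =>
    intro x hx
    change curvature c x = curvature c' x
    simp only [curvature, normal]
    rw [arcDeriv_congr h hτ hx, hτ x hx]
  | succ ℓ ih =>
    intro x hx
    simp only [curvatureDeriv, Function.iterate_succ_apply']
    exact arcDeriv_congr h ih hx

lemma arcIntegral_congr {c c' : ℝ → Plane} (h : ∀ x ∈ paramInterval, c x = c' x) {f g : ℝ → ℝ}
    (hfg : ∀ x ∈ paramInterval, f x = g x) : arcIntegral c f = arcIntegral c' g := by
  refine intervalIntegral.integral_congr fun x hx => ?_
  rw [uIcc_param] at hx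
  simp only [speed]
  rw [hfg x hx, velocity_congr h hx]

lemma isTimeSet_timeInterval {T : EReal} (hT : 0 < T) : IsTimeSet (timeInterval T) := by
  constructor
  · refine Set.OrdConnected.convex ⟨fun a ha b hb c hc => ⟨ha.1.trans hc.1, ?_⟩⟩
    exact lt_of_le_of_lt (EReal.coe_le_coe_iff.2 hc.2) hb.2
  · obtain ⟨r, hr0, hrT⟩ := EReal.lt_iff_exists_real_btwn.1 hT
    have hr : 0 < r := by exact_mod_cast hr0
    refine ⟨r / 2, mem_interior.2 ⟨Ioo 0 r, fun s hs => ⟨hs.1.le, ?_⟩, isOpen_Ioo,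
      ⟨by linarith, by linarith⟩⟩⟩
    exact lt_trans (EReal.coe_lt_coe_iff.2 hs.2) hrT

lemma timeInterval_top : timeInterval ⊤ = Ici 0 := by
  ext t
  simp [timeInterval, EReal.coe_lt_top]

namespace IsSolution

variable {m : ℕ} {e : Plane} {a d : ℝ} {γ₀ : ℝ → Plane} {T : EReal} {γ : ℝ → ℝ → Plane}

lemma neumannFlow (h : IsSolution m e a d γ₀ T γ) (hT : 0 < T) (he : ‖e‖ = 1) :
    NeumannFlow m (timeInterval T) γ := by
  have hI := isTimeSet_timeInterval hT
  have hF : SmoothFamily (timeInterval T) γ :=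
    ⟨hI, h.smooth, fun t ht x hx => (h.neumann t ht).immersed x hx⟩
  have hN : NormalFlow (timeInterval T) γ (force m γ) :=
    { hF with
      smooth_force := contDiffOn_const.mul (hF.smooth_curv (2 * m + 2))
      flow := fun t ht x hx => (h.flow t ht x hx).derivWithin (hI.uniqueDiffOn t ht) }
  refine { hN with odd := ?_ }
  rintro t ht _ ⟨i, rfl⟩
  exact ⟨hN.curv_odd_eq_zero he (by simp) (fun r hr => (h.neumann r hr).left_orthogonal)
      (fun r hr => (h.neumann r hr).left_odd) i t ht,
    hN.curv_odd_eq_zero he (by simp) (fun r hr => (h.neumann r hr).right_orthogonal)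
      (fun r hr => (h.neumann r hr).right_odd) i t ht⟩

lemma zero_mem (hT : 0 < T) : (0 : ℝ) ∈ timeInterval T := ⟨le_rfl, by simpa using hT⟩

lemma wint_curvature_eq_zero (h : IsSolution m e a d γ₀ T γ) (hT : 0 < T) (he : ‖e‖ = 1)
    (hw : windingNumber γ₀ = 0) :
    ∀ t ∈ timeInterval T, wint (speed (γ t)) (curv γ 0 t) = 0 := by
  intro t ht
  refine (h.neumannFlow hT he).wint_curvature_eq_zero (zero_mem hT) ?_ ht
  have h1 : arcIntegral (γ 0) (curvature (γ 0)) = arcIntegral γ₀ (curvature γ₀) :=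
    arcIntegral_congr h.initial (curvatureDeriv_congr h.initial 0)
  refine h1.trans ?_
  exact (mul_eq_zero.1 hw).resolve_left (inv_ne_zero (by positivity))

lemma curvLength_zero (h : IsSolution m e a d γ₀ T γ) : curvLength γ 0 = length γ₀ :=
  arcIntegral_congr h.initial fun _ _ => rfl

lemma curvEnergy_zero (h : IsSolution m e a d γ₀ T γ) (ℓ : ℕ) :
    curvEnergy γ ℓ 0 = arcIntegral γ₀ (fun x => curvatureDeriv γ₀ ℓ x ^ 2) :=
  arcIntegral_congr h.initial fun x hx => by
    rw [← curvatureDeriv_congr h.initial ℓ x hx]; rfl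

end IsSolution

end PolyharmonicFlow

end

theorem corollary3p4 (m : ℕ) :
    ∃ ε : ℝ, 0 < ε ∧
    ∃ δ δ' : ℕ → ℝ → ℝ,
      (∀ (ℓ : ℕ) (L₀ : ℝ), 0 < L₀ → 0 < δ ℓ L₀ ∧ 0 < δ' ℓ L₀) ∧
      ∀ (e : PolyharmonicFlow.Plane) (a d : ℝ) (γ₀ : ℝ → PolyharmonicFlow.Plane),
        ‖e‖ = 1 → 0 < d →
        PolyharmonicFlow.IsNeumannCurve m e a d γ₀ →
        PolyharmonicFlow.windingNumber γ₀ = 0 →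
        -- solutions that exist for all time
        (PolyharmonicFlow.arcIntegral γ₀
            (fun x => PolyharmonicFlow.curvature γ₀ x ^ 2) ≤ ε →
          ∀ γ : ℝ → ℝ → PolyharmonicFlow.Plane,
            PolyharmonicFlow.IsSolution m e a d γ₀ ⊤ γ →
            ∀ ℓ : ℕ, ∃ C C' : ℝ, ∀ t : ℝ, 0 ≤ t →
              PolyharmonicFlow.arcIntegral (γ t)
                  (fun x => PolyharmonicFlow.curvatureDeriv (γ t) ℓ x ^ 2)
                ≤ C * Real.exp (-(δ ℓ (PolyharmonicFlow.length γ₀)) * t) ∧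
              ∀ x ∈ Set.Icc (-1 : ℝ) 1,
                |PolyharmonicFlow.curvatureDeriv (γ t) ℓ x|
                  ≤ C' * Real.exp (-(δ' ℓ (PolyharmonicFlow.length γ₀)) * t)) ∧
        -- all solutions, as long as they exist, with constants that depend only on the initial curve
        (PolyharmonicFlow.length γ₀ * PolyharmonicFlow.arcIntegral γ₀
            (fun x => PolyharmonicFlow.curvature γ₀ x ^ 2) ≤ ε →
          ∀ ℓ : ℕ, ∃ C C' : ℝ, ∀ (T : EReal) (γ : ℝ → ℝ → PolyharmonicFlow.Plane),
            0 < T → PolyharmonicFlow.IsSolution m e a d γ₀ T γ →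
            ∀ t : ℝ, 0 ≤ t → (t : EReal) < T →
              PolyharmonicFlow.arcIntegral (γ t)
                  (fun x => PolyharmonicFlow.curvatureDeriv (γ t) ℓ x ^ 2)
                ≤ C * Real.exp (-(δ ℓ (PolyharmonicFlow.length γ₀)) * t) ∧
              ∀ x ∈ Set.Icc (-1 : ℝ) 1,
                |PolyharmonicFlow.curvatureDeriv (γ t) ℓ x|
                  ≤ C' * Real.exp (-(δ' ℓ (PolyharmonicFlow.length γ₀)) * t)) := by
  open PolyharmonicFlow in
  -- The L² rates may be the same for every ℓ; the supremum rates are half of them because a square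
  -- root is taken.
  refine ⟨smallness m, smallness_pos m, fun _ L₀ => decayRate m L₀,
    fun _ L₀ => decayRate m L₀ / 2,
    fun _ L₀ hL => ⟨decayRate_pos m hL, half_pos (decayRate_pos m hL)⟩, ?_⟩
  intro e a d γ₀ he _ _ hw
  refine ⟨fun _ γ hγ ℓ => ?_, fun hs ℓ => ?_⟩
  · have hflow := hγ.neumannFlow EReal.zero_lt_top he
    have hm := hγ.wint_curvature_eq_zero EReal.zero_lt_top he hw
    rw [timeInterval_top] at hflow hm
    obtain ⟨C, hC⟩ := hflow.exists_decay hm hγ.curvLength_zero.le ℓ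
    obtain ⟨C₁, hC₁⟩ := hflow.exists_decay hm hγ.curvLength_zero.le (ℓ + 1)
    refine ⟨C, √(PolyharmonicFlow.length γ₀ * C₁), fun t ht => ⟨hC t ht, fun x hx => ?_⟩⟩
    exact hflow.abs_curv_le ht (hm t ht)
      ((hflow.antitoneOn_curvLength self_mem_Ici ht ht).trans hγ.curvLength_zero.le) (hC₁ t ht) hx
  -- These constants involve only the initial length and energies, so they are chosen before T and
  -- the solution.
  · let K : ℕ → ℝ := fun i => decayConst m i (PolyharmonicFlow.length γ₀)
      (arcIntegral γ₀ (fun x => curvatureDeriv γ₀ 0 x ^ 2))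
      (arcIntegral γ₀ (fun x => curvatureDeriv γ₀ i x ^ 2))
    refine ⟨K ℓ, √(PolyharmonicFlow.length γ₀ * K (ℓ + 1)), fun T γ hT hγ t ht htT => ?_⟩
    have hflow := hγ.neumannFlow hT he
    have hm := hγ.wint_curvature_eq_zero hT he hw
    have h0 := IsSolution.zero_mem hT
    have htI : t ∈ timeInterval T := ⟨ht, htT⟩
    have hs' : curvLength γ 0 * curvEnergy γ 0 0 ≤ smallness m := by
      rw [hγ.curvLength_zero, hγ.curvEnergy_zero]
      exact hs
    have hdecay : ∀ i, curvEnergy γ i t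
        ≤ K i * Real.exp (-decayRate m (PolyharmonicFlow.length γ₀) * t) := by
      intro i
      have h1 := hflow.curvEnergy_le hm h0 hγ.curvLength_zero.le hs' htI ht i
      rwa [hγ.curvEnergy_zero, hγ.curvEnergy_zero, sub_zero, ← neg_mul] at h1
    exact ⟨hdecay ℓ, fun x hx => hflow.abs_curv_le htI (hm t htI)
      ((hflow.antitoneOn_curvLength h0 htI ht).trans hγ.curvLength_zero.le) (hdecay (ℓ + 1)) hx⟩
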